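/- Let $V$ be a real Banach space, let $\mathbb{R}_5$ be the real Clifford algebra generated by $e_1,\dots,e_5$ with $e_ie_j=-e_je_i$ ($i\ne j$), $e_i^2=-1$, let $V_5=V\otimes\mathbb{R}_5$, and let $\mathcal{B}(V_5)$ be the algebra of bounded right linear operators on $V_5$. Points $x=(x_0,\dots,x_5)\in\mathbb{R}^6$ are identified with the paravectors $x_0+\sum_i x_ie_i$; put $\mathrm{Re}(x)=x_0$, $\underline{x}=\sum_i x_ie_i$, let $\mathbb{S}$ be the set of the unit vectors $I=\sum_i x_ie_i$, so that $I^2=-1$, and let $\mathbb{C}_I=\mathbb{R}+I\mathbb{R}$. A set $U\subseteq\mathbb{R}^6$ is axially symmetric if it contains $\mathrm{Re}(x)+J|\underline{x}|$ whenever $x\in U$ and $J\in\mathbb{S}$; a slice Cauchy domain is an axially symmetric open set $U$ such that, for every $I\in\mathbb{S}$, $U\cap\mathbb{C}_I$ is a Cauchy domain in $\mathbb{C}_I$, i.e. its boundary consists of finitely many pairwise disjoint piecewise $C^1$ Jordan curves which, positively oriented, have total winding number $1$ around every point of $U\cap\mathbb{C}_I$ and $0$ around every point outside its closure. Let $T=T_0+\sum_{i=1}^5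 e_iT_i$ with pairwise commuting bounded linear operators $T_i$ on $V$, where $T_0=0$ and $T_1,\dots,T_5$ have real spectra. Put $\overline{T}=T_0-\sum_i e_iT_i$, let $$\sigma_S(T)=\{s\in\mathbb{R}^6 : T^2-2\,\mathrm{Re}(s)T+|s|^2\mathcal{I}\ \text{is not invertible in } \mathcal{B}(V_5)\},$$ and for $s\in\mathbb{R}^6\setminus\sigma_S(T)$ let $$S^{-1}_{D\Delta,L}(s,T)=S^{-1}_{D\Delta,R}(s,T)=16\,\mathcal{Q}_{c,s}(T)^{-2},\qquad \mathcal{Q}_{c,s}(T)=s^2\mathcal{I}-s(T+\overline{T})+T\overline{T}.$$ **Theorem.** Assume that $\sigma_S(T)=\sigma_{S,1}(T)\cup\sigma_{S,2}(T)$ with $\mathrm{dist}(\sigma_{S,1}(T),\sigma_{S,2}(T))>0$, and let $G_1,G_2\subset\mathbb{R}^6$ be bounded slice Cauchy domains with $\sigma_{S,1}(T)\subset G_1$, $\overline{G_1}\subset G_2$ and $\mathrm{dist}(G_2,\sigma_{S,2}(T))>0$ (distances to the empty set being $+\infty$). Then, with $ds_I=ds\,(-I)$ and the boundaries positively oriented,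 $$P:=\frac{1}{32\pi}\int_{\partial(G_1\cap\mathbb{C}_I)}S^{-1}_{D\Delta,R}(p,T)\,dp_I\,p^3=\frac{1}{32\pi}\int_{\partial(G_2\cap\mathbb{C}_I)}s^3\,ds_I\,S^{-1}_{D\Delta,L}(s,T)$$ for every $I\in\mathbb{S}$, the operator $P\in\mathcal{B}(V_5)$ does not depend on $I\in\mathbb{S}$, and $P$ is a projector: $P^2=P$. -/

import Mathlib

open MeasureTheory Set
open scoped Topology

noncomputable section

namespace Clifford5

universe u

/-! ### The Clifford algebra with five imaginary units acting on its module -/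

/-- The sign in `e_i e_A = ± e_{A ∆ {i}}`, where `e_A = e_{l_1} ⋯ e_{l_r}` for
`A = {l_1 < ⋯ < l_r}`, `e_i e_j = - e_j e_i` for `i ≠ j`, and `e_i ^ 2 = -1`. -/
def leftSign (i : Fin 5) (A : Finset (Fin 5)) : ℤ :=
  (-1) ^ (A.filter (fun j => j ≤ i)).card

/-- The sign in `e_A e_i = ± e_{A ∆ {i}}`. -/
def rightSign (i : Fin 5) (A : Finset (Fin 5)) : ℤ :=
  (-1) ^ (A.filter (fun j => i ≤ j)).card

section Module

variable (V : Type u) [NormedAddCommGroup V] [NormedSpace ℝ V]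

/-- The module `V₅ = V ⊗ ℝ₅`: the family `v` stands for `∑_A e_A v_A`. The norm is the maximum of
the norms of the coefficients (all the usual norms on `V₅` are equivalent to it). -/
abbrev CliffordModule : Type u := Finset (Fin 5) → V

/-- Left multiplication `v ↦ e_i v` on `V₅`. -/
def leftMul (i : Fin 5) : CliffordModule V →L[ℝ] CliffordModule V :=
  ContinuousLinearMap.pi fun B =>
    ((leftSign i (symmDiff B {i}) : ℤ) : ℝ) •
      (ContinuousLinearMap.proj (symmDiff B {i}) : CliffordModule V →L[ℝ] V)

/-- Right multiplication `v ↦ v e_i` on `V₅`. -/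
def rightMul (i : Fin 5) : CliffordModule V →L[ℝ] CliffordModule V :=
  ContinuousLinearMap.pi fun B =>
    ((rightSign i (symmDiff B {i}) : ℤ) : ℝ) •
      (ContinuousLinearMap.proj (symmDiff B {i}) : CliffordModule V →L[ℝ] V)

/-- The Banach algebra `𝓑(V₅)` of bounded right linear operators on `V₅`: the bounded real linear
operators which commute with the right multiplications by `e_1, …, e_5`, that is, by `ℝ₅`. -/
abbrev CliffordOp : Subalgebra ℝ (CliffordModule V →L[ℝ] CliffordModule V) :=
  Subalgebra.centralizer ℝ (Set.range (rightMul V))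

/-- `𝓑(V₅)` is complete, so that Bochner integrals with values in it make sense. -/
instance instCompleteSpaceCliffordOp [CompleteSpace V] : CompleteSpace (CliffordOp V) :=
  IsClosed.completeSpace_coe (s := Set.centralizer (Set.range (rightMul V)))
    (hs := Set.isClosed_centralizer _)

end Module

section Operators

variable {V : Type u} [NormedAddCommGroup V] [NormedSpace ℝ V]

theorem leftMul_mem (i : Fin 5) : leftMul V i ∈ CliffordOp V := by
  rw [Subalgebra.mem_centralizer_iff]
  rintro _ ⟨j, rfl⟩
  ext v B
  have h : ∀ (i j : Fin 5) (B : Finset (Fin 5)),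
      symmDiff (symmDiff B {j}) {i} = symmDiff (symmDiff B {i}) {j} := by decide
  have h2 : ∀ (i j : Fin 5) (B : Finset (Fin 5)),
      rightSign j (symmDiff B {j}) * leftSign i (symmDiff (symmDiff B {j}) {i}) =
      leftSign i (symmDiff B {i}) * rightSign j (symmDiff (symmDiff B {i}) {j}) := by decide
  have h3 := congrArg (fun z : ℤ => (z : ℝ)) (h2 i j B)
  push_cast at h3
  rw [h i j B] at h3
  simp [leftMul, rightMul, smul_smul, h3, h i j B]

/-- The Clifford unit `e_i` as an element of `𝓑(V₅)`. -/
def e (i : Fin 5) : CliffordOp V := ⟨leftMul V i, leftMul_mem i⟩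

theorem e_mul_self (i : Fin 5) : (e i * e i : CliffordOp V) = -1 := by
  apply Subtype.ext
  ext v B
  have h2 : ∀ (i : Fin 5) (B : Finset (Fin 5)),
      leftSign i (symmDiff B {i}) * leftSign i B = -1 := by decide
  have h3 := congrArg (fun z : ℤ => (z : ℝ)) (h2 i B)
  push_cast at h3
  simp [e, leftMul, smul_smul, h3]

theorem e_mul_e (i j : Fin 5) (hij : i ≠ j) : (e i * e j : CliffordOp V) = -(e j * e i) := by
  apply Subtype.ext
  ext v B
  have h : ∀ (i j : Fin 5) (B : Finset (Fin 5)),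
      symmDiff (symmDiff B {i}) {j} = symmDiff (symmDiff B {j}) {i} := by decide
  have h2 : ∀ (i j : Fin 5), i ≠ j → ∀ (B : Finset (Fin 5)),
      leftSign i (symmDiff B {i}) * leftSign j (symmDiff (symmDiff B {j}) {i}) =
      - (leftSign j (symmDiff B {j}) * leftSign i (symmDiff (symmDiff B {j}) {i})) := by decide
  have h3 := congrArg (fun z : ℤ => (z : ℝ)) (h2 i j hij B)
  push_cast at h3
  simp [e, leftMul, smul_smul, h3, h i j B]

/-- A bounded operator `A` on `V` acts on `V₅` by `∑_B e_B v_B ↦ ∑_B e_B A v_B`. -/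
def ofComponent (A : V →L[ℝ] V) : CliffordOp V :=
  ⟨ContinuousLinearMap.pi fun B =>
      A.comp (ContinuousLinearMap.proj B : CliffordModule V →L[ℝ] V), by
    rw [Subalgebra.mem_centralizer_iff]
    rintro _ ⟨j, rfl⟩
    ext v B
    simp [rightMul]⟩

/-- Multiplication by the paravector `x = x_0 + x_1 e_1 + ⋯ + x_5 e_5`, as an element of `𝓑(V₅)`.
Products such as `x B` and `B x` with `B ∈ 𝓑(V₅)` are products in `𝓑(V₅)` with this element. -/
def para (x : EuclideanSpace ℝ (Fin 6)) : CliffordOp V :=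
  x 0 • 1 + ∑ i : Fin 5, x i.succ • e i

variable (V) in
/-- The class `𝓑𝓒^{0,1}(V₅)` of paravector operators `T_0 + e_1 T_1 + ⋯ + e_5 T_5` with pairwise
commuting components, given by the components. -/
structure ParavectorOp where
  /-- the components `T_0, …, T_5` -/
  comp : Fin 6 → V →L[ℝ] V
  commute : ∀ i j, Commute (comp i) (comp j)

namespace ParavectorOp

variable (T : ParavectorOp V)

/-- `T = T_0 + e_1 T_1 + ⋯ + e_5 T_5` as an element of `𝓑(V₅)`. -/
def op : CliffordOp V :=
  ofComponent (T.comp 0) + ∑ i : Fin 5, e i * ofComponent (T.comp i.succ)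

/-- The conjugate operator `T_0 - e_1 T_1 - ⋯ - e_5 T_5`. -/
def conj : CliffordOp V :=
  ofComponent (T.comp 0) - ∑ i : Fin 5, e i * ofComponent (T.comp i.succ)

/-- The `S`-spectrum: the `s ∈ ℝ⁶` such that `T ^ 2 - 2 Re(s) T + |s| ^ 2` is not invertible
in `𝓑(V₅)`. -/
def sSpectrum : Set (EuclideanSpace ℝ (Fin 6)) :=
  {s | ¬ IsUnit (T.op ^ 2 - (2 * s 0) • T.op + (‖s‖ ^ 2) • (1 : CliffordOp V))}

/-- `𝓠_{c,s}(T) = s ^ 2 - s (T + conj T) + T conj T`. -/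
def Qc (s : EuclideanSpace ℝ (Fin 6)) : CliffordOp V :=
  para s ^ 2 - para s * (T.op + T.conj) + T.op * T.conj

/-- The resolvent operator `S⁻¹_{DΔ,L}(s,T) = S⁻¹_{DΔ,R}(s,T) = 16 𝓠_{c,s}(T)⁻²` of the harmonic
functional calculus. -/
def harmonicResolvent (s : EuclideanSpace ℝ (Fin 6)) : CliffordOp V :=
  (16 : ℝ) • Ring.inverse (T.Qc s) ^ 2

end ParavectorOp

/-- The (complex) spectrum of a bounded operator `A` on the real Banach space `V`. For `z = a + i b`
one has `(A - z)(A - conj z) = (A - a) ^ 2 + b ^ 2` on the complexification of `V`, and complex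
conjugation shows that `A - z` is invertible there if and only if `A - conj z` is. -/
def complexSpectrum (A : V →L[ℝ] V) : Set ℂ :=
  {z | ¬ IsUnit ((A - z.re • (1 : V →L[ℝ] V)) ^ 2 + (z.im ^ 2) • (1 : V →L[ℝ] V))}

/-- The spectrum of `A` is real. -/
def HasRealSpectrum (A : V →L[ℝ] V) : Prop :=
  ∀ z ∈ complexSpectrum A, z.im = 0

end Operators

/-! ### Axially symmetric sets and slice Cauchy domains -/

/-- The sphere `𝕊` of unit vectors `x_1 e_1 + ⋯ + x_5 e_5`. -/
def unitSphere : Set (EuclideanSpace ℝ (Fin 5)) := Metric.sphere 0 1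

/-- The point `u + I v ∈ ℂ_I ⊆ ℝ⁶` for `z = u + i v`. -/
def slicePoint (I : EuclideanSpace ℝ (Fin 5)) (z : ℂ) : EuclideanSpace ℝ (Fin 6) :=
  WithLp.toLp 2 (Fin.cons z.re fun i => z.im * I i)

/-- The vector part of a paravector. -/
def vecPart (x : EuclideanSpace ℝ (Fin 6)) : EuclideanSpace ℝ (Fin 5) :=
  WithLp.toLp 2 fun i => x i.succ

/-- `U` contains with `x` the whole set `[x] = {Re x + I |vec x| : I ∈ 𝕊}`. -/
def AxiallySymmetric (U : Set (EuclideanSpace ℝ (Fin 6))) : Prop :=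
  ∀ x ∈ U, ∀ I ∈ unitSphere, slicePoint I ⟨x 0, ‖vecPart x‖⟩ ∈ U

/-- The set `U ∩ ℂ_I`, seen as a subset of the complex plane. -/
def slice (U : Set (EuclideanSpace ℝ (Fin 6))) (I : EuclideanSpace ℝ (Fin 5)) : Set ℂ :=
  {z | slicePoint I z ∈ U}

/-- `γ`, restricted to `[0, 1]`, is a closed simple curve which is `C¹` on each of the closed
intervals of some finite partition of `[0, 1]`. -/
def IsPiecewiseC1Jordan (γ : ℝ → ℂ) : Prop :=
  ContinuousOn γ (Icc 0 1) ∧ γ 0 = γ 1 ∧ InjOn γ (Ico 0 1) ∧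
    ∃ (n : ℕ) (t : Fin (n + 1) → ℝ), StrictMono t ∧ t 0 = 0 ∧ t (Fin.last n) = 1 ∧
      ∀ k : Fin n, ContDiffOn ℝ 1 γ (Icc (t k.castSucc) (t k.succ))

/-- The winding number of the closed curve `γ` around `z`. -/
def windingNumber (γ : ℝ → ℂ) (z : ℂ) : ℂ :=
  (2 * Real.pi * Complex.I)⁻¹ * ∫ t in (0 : ℝ)..1, deriv γ t / (γ t - z)

/-- The curves `γ 0, …, γ (m - 1)` form the positively oriented boundary of `D`: they are pairwise
disjoint piecewise `C¹` Jordan curves whose union is the boundary of `D`, and together they wind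
once around each point of `D` and zero times around each point outside the closure of `D`. -/
structure IsPositiveBoundary (D : Set ℂ) {m : ℕ} (γ : Fin m → ℝ → ℂ) : Prop where
  jordan : ∀ k, IsPiecewiseC1Jordan (γ k)
  disjoint : Pairwise fun k l => Disjoint (γ k '' Icc 0 1) (γ l '' Icc 0 1)
  frontier_eq : ⋃ k, γ k '' Icc 0 1 = frontier D
  inside : ∀ z ∈ D, ∑ k, windingNumber (γ k) z = 1
  outside : ∀ z ∉ closure D, ∑ k, windingNumber (γ k) z = 0

/-- Cauchy domains in the plane. -/
def IsCauchyDomain (D : Set ℂ) : Prop :=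
  IsOpen D ∧ ∃ (m : ℕ) (γ : Fin m → ℝ → ℂ), IsPositiveBoundary D γ

/-- Slice Cauchy domains. -/
structure IsSliceCauchyDomain (U : Set (EuclideanSpace ℝ (Fin 6))) : Prop where
  isOpen : IsOpen U
  axiallySymmetric : AxiallySymmetric U
  cauchyDomain : ∀ I ∈ unitSphere, IsCauchyDomain (slice U I)

/-! ### Integrals over the boundary of a slice -/

/-- The integral over the positively oriented boundary of `D` of the form whose value at the point
`z` on the tangent vector `w` is `F z w` exists and is equal to `P`, whichever parametrization of
the oriented boundary is used. -/
def HasBoundaryIntegral {E : Type*} [NormedAddCommGroup E] [NormedSpace ℝ E]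
    (D : Set ℂ) (F : ℂ → ℂ → E) (P : E) : Prop :=
  ∀ (m : ℕ) (γ : Fin m → ℝ → ℂ), IsPositiveBoundary D γ →
    (∀ k, IntervalIntegrable (fun t => F (γ k t) (deriv (γ k) t)) volume 0 1) ∧
      ∑ k, ∫ t in (0 : ℝ)..1, F (γ k t) (deriv (γ k) t) = P

section Forms

variable {V : Type u} [NormedAddCommGroup V] [NormedSpace ℝ V]

/-- The form `ds_I = ds (-I)` on `ℂ_I`, evaluated on the tangent vector `w`. -/
def dsI (I : EuclideanSpace ℝ (Fin 5)) (w : ℂ) : CliffordOp V :=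
  para (slicePoint I w) * -para (slicePoint I Complex.I)

/-- The form `S⁻¹_{DΔ,R}(p,T) dp_I p³` on `ℂ_I`, with `p = u + I v` for `z = u + i v`. -/
def rightForm (T : ParavectorOp V) (I : EuclideanSpace ℝ (Fin 5)) (z w : ℂ) : CliffordOp V :=
  T.harmonicResolvent (slicePoint I z) * dsI I w * para (slicePoint I z) ^ 3

/-- The form `s³ ds_I S⁻¹_{DΔ,L}(s,T)` on `ℂ_I`, with `s = u + I v` for `z = u + i v`. -/
def leftForm (T : ParavectorOp V) (I : EuclideanSpace ℝ (Fin 5)) (z w : ℂ) : CliffordOp V :=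
  para (slicePoint I z) ^ 3 * dsI I w * T.harmonicResolvent (slicePoint I z)

end Forms

end Clifford5

end

noncomputable section

namespace Clifford5

universe u

/-! Complexify `V`. For `I ∈ 𝕊` the map `X + iY ↦ X + IY` (`sliceMap`) is multiplicative from the
complex operators on the complexification to `𝓑(V₅)` (`sliceMap_mul`), because `I² = -1` and `I`
commutes with operators acting on components. Since `T_0 = 0`, the conjugate of `T` is `-T` and `T²
= -∑ T_i²`, so `𝓠_{c,s}(T)` at `s = u + Iv` is the image of `z² - B`, where `z = u + iv` and `B`
(`sqOp`) is the complexification of `-∑ T_i²`. With `R(ζ) = (ζ - B)⁻¹`, both forms, divided by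
`32π`, are the image of `(2πi)⁻¹ z³ R(z²)² dz` (`leftForm_eq`, `rightForm_eq`).

As `z² R(z²) = 1 + B R(z²)`, this integrand is `z R(z²)` plus `B` times an exact derivative
(`cycleIntegral_pow_three_smul`). What is left is a Riesz projection of `B` in the variable `ζ =
z²`, on a contour that sees both `z` and `-z`. Instead of deforming contours, the proof
characterizes the value `P`: `R(z²)(1 - P)` extends holomorphically near the inner singularities and
`R(z²)P` near the outer ones (`cycleIntegral_isSpectralProjection`). Liouville's theorem shows that
this determines `P` and forces `P² = P`. The boundaries of `G₁` and `G₂` satisfy the same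
characterization, so they give the same `P`.

Real spectra enter through Gelfand theory: if `z²` is in the spectrum of `B`, then `z` is purely
imaginary (`re_eq_zero_of_sq_mem_spectrum`). Hence `-z` is the complex conjugate of `z`, and axial
symmetry puts `z` and `-z` on the same side of each boundary. Finally `P` is invariant under complex
conjugation, so it has no imaginary part and its image in `𝓑(V₅)` does not involve `I`. -/

/-! ### Integrals over cycles in the plane -/

/-- A closed curve along which continuous functions can be integrated, and for which the
fundamental theorem of calculus holds. -/
structure IsClosedCurve (γ : ℝ → ℂ) : Prop where
  continuousOn : ContinuousOn γ (Icc 0 1)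
  closed : γ 0 = γ 1
  integrable : IntervalIntegrable (deriv γ) volume 0 1
  differentiable : ∃ s : Set ℝ, s.Countable ∧ ∀ t ∈ Ioo (0 : ℝ) 1 \ s, DifferentiableAt ℝ γ t

theorem IsPiecewiseC1Jordan.isClosedCurve {γ : ℝ → ℂ} (h : IsPiecewiseC1Jordan γ) :
    IsClosedCurve γ := by
  obtain ⟨hc, hcl, -, n, t, ht, h0, h1, hd⟩ := h
  refine ⟨hc, hcl, ?_, range t, (finite_range t).countable, ?_⟩
  -- The partition is extended to all of `ℕ` for `trans_iterate`; the default value `0` is never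
  -- used, since only indices up to `n` occur.
  · let a : ℕ → ℝ := fun j => if hj : j < n + 1 then t ⟨j, hj⟩ else 0
    have ha : ∀ j (hj : j < n + 1), a j = t ⟨j, hj⟩ := fun j hj => dif_pos hj
    have e0 : a 0 = 0 := by rw [ha 0 (Nat.succ_pos n), ← h0]; rfl
    have e1 : a n = 1 := by rw [ha n (Nat.lt_succ_self n), ← h1]; rfl
    rw [← e0, ← e1]
    refine IntervalIntegrable.trans_iterate fun k hk => ?_
    rw [ha k (by omega), ha (k + 1) (by omega)]
    have hlt : t ⟨k, by omega⟩ < t ⟨k + 1, by omega⟩ := ht (by simp [Fin.lt_def])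
    have hk' : ContDiffOn ℝ 1 γ (Icc (t ⟨k, by omega⟩) (t ⟨k + 1, by omega⟩)) := hd ⟨k, hk⟩
    have hcd := hk'.continuousOn_derivWithin (uniqueDiffOn_Icc hlt) le_rfl
    have hi : IntervalIntegrable (derivWithin γ (Icc (t ⟨k, by omega⟩) (t ⟨k + 1, by omega⟩)))
        volume (t ⟨k, by omega⟩) (t ⟨k + 1, by omega⟩) :=
      ContinuousOn.intervalIntegrable (by rwa [uIcc_of_le hlt.le])
    -- `deriv` and `derivWithin` may differ at the break points, so the comparison is made on the
    -- open interval.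
    rw [intervalIntegrable_iff_integrableOn_Ioo_of_le hlt.le] at hi ⊢
    refine hi.congr_fun (fun x hx => ?_) measurableSet_Ioo
    exact derivWithin_of_mem_nhds (Icc_mem_nhds hx.1 hx.2)
  · rintro x ⟨hx, hxs⟩
    -- Induction on `j` finds the partition interval whose interior contains `x`.
    have key : ∀ j (hj : j < n + 1), x < t ⟨j, hj⟩ → DifferentiableAt ℝ γ x := by
      intro j
      induction j with
      | zero => intro hj hlt; exact absurd (hlt.trans_eq h0) (not_lt.2 hx.1.le)
      | succ j ih =>
        intro hj hlt
        by_cases hxj : x < t ⟨j, by omega⟩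
        · exact ih _ hxj
        · have hlt' : t ⟨j, by omega⟩ < x :=
            lt_of_le_of_ne (not_lt.1 hxj) fun he => hxs ⟨_, he⟩
          have hk' : ContDiffOn ℝ 1 γ (Icc (t ⟨j, by omega⟩) (t ⟨j + 1, by omega⟩)) :=
            hd ⟨j, by omega⟩
          exact (hk'.contDiffAt (Icc_mem_nhds hlt' hlt)).differentiableAt one_ne_zero
    exact key n (Nat.lt_succ_self n) (hx.2.trans_eq h1.symm)

section Cycle

variable {E F : Type*} [NormedAddCommGroup E] [NormedSpace ℂ E] {m : ℕ}

/-- The points on the curves of a cycle. -/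
def cycleSupport (γ : Fin m → ℝ → ℂ) : Set ℂ := ⋃ k, γ k '' Icc 0 1

/-- The integral `∮ f(w) dw` over the cycle `γ`. -/
def cycleIntegral (γ : Fin m → ℝ → ℂ) (f : ℂ → E) : E :=
  ∑ k, ∫ t in (0 : ℝ)..1, deriv (γ k) t • f (γ k t)

theorem mem_cycleSupport (γ : Fin m → ℝ → ℂ) (k : Fin m) {t : ℝ} (ht : t ∈ Icc (0 : ℝ) 1) :
    γ k t ∈ cycleSupport γ := mem_iUnion.2 ⟨k, t, ht, rfl⟩

variable {γ : Fin m → ℝ → ℂ} (hγ : ∀ k, IsClosedCurve (γ k))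
include hγ

theorem isCompact_cycleSupport : IsCompact (cycleSupport γ) :=
  isCompact_iUnion fun k => isCompact_Icc.image_of_continuousOn (hγ k).continuousOn

omit [NormedSpace ℂ E] in
theorem continuousOn_comp_curve {f : ℂ → E} (hf : ContinuousOn f (cycleSupport γ)) (k : Fin m) :
    ContinuousOn (fun t => f (γ k t)) (Icc 0 1) :=
  hf.comp (hγ k).continuousOn fun _ ht => mem_cycleSupport γ k ht

theorem cycle_intervalIntegrable {f : ℂ → E} (hf : ContinuousOn f (cycleSupport γ)) (k : Fin m) :
    IntervalIntegrable (fun t => deriv (γ k) t • f (γ k t)) volume 0 1 := by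
  refine (hγ k).integrable.smul_continuousOn ?_
  rw [uIcc_of_le zero_le_one]
  exact continuousOn_comp_curve hγ hf k

theorem cycleIntegral_add {f g : ℂ → E} (hf : ContinuousOn f (cycleSupport γ))
    (hg : ContinuousOn g (cycleSupport γ)) :
    cycleIntegral γ (fun w => f w + g w) = cycleIntegral γ f + cycleIntegral γ g := by
  unfold cycleIntegral
  rw [← Finset.sum_add_distrib]
  refine Finset.sum_congr rfl fun k _ => ?_
  rw [← intervalIntegral.integral_add (cycle_intervalIntegrable hγ hf k)
    (cycle_intervalIntegrable hγ hg k)]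
  simp only [smul_add]

theorem cycleIntegral_sub {f g : ℂ → E} (hf : ContinuousOn f (cycleSupport γ))
    (hg : ContinuousOn g (cycleSupport γ)) :
    cycleIntegral γ (fun w => f w - g w) = cycleIntegral γ f - cycleIntegral γ g := by
  unfold cycleIntegral
  rw [← Finset.sum_sub_distrib]
  refine Finset.sum_congr rfl fun k _ => ?_
  rw [← intervalIntegral.integral_sub (cycle_intervalIntegrable hγ hf k)
    (cycle_intervalIntegrable hγ hg k)]
  simp only [smul_sub]

theorem cycleIntegral_clm [NormedAddCommGroup F] [NormedSpace ℂ F] [CompleteSpace E]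
    [CompleteSpace F] (L : E →L[ℂ] F) {f : ℂ → E} (hf : ContinuousOn f (cycleSupport γ)) :
    cycleIntegral γ (fun w => L (f w)) = L (cycleIntegral γ f) := by
  unfold cycleIntegral
  rw [map_sum]
  refine Finset.sum_congr rfl fun k _ => ?_
  rw [← L.intervalIntegral_comp_comm (cycle_intervalIntegrable hγ hf k)]
  simp only [map_smul]

omit hγ in
theorem cycleIntegral_congr {f g : ℂ → E} (h : ∀ w ∈ cycleSupport γ, f w = g w) :
    cycleIntegral γ f = cycleIntegral γ g := by
  unfold cycleIntegral
  refine Finset.sum_congr rfl fun k _ => intervalIntegral.integral_congr fun t ht => ?_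
  rw [uIcc_of_le zero_le_one] at ht
  simp only [h _ (mem_cycleSupport γ k ht)]

theorem cycleIntegral_eq_zero_of_hasDerivAt [CompleteSpace E] {f G : ℂ → E}
    (hf : ContinuousOn f (cycleSupport γ))
    (hG : ∀ w ∈ cycleSupport γ, HasDerivAt G (f w) w) : cycleIntegral γ f = 0 := by
  refine Finset.sum_eq_zero fun k _ => ?_
  obtain ⟨s, hs, hd⟩ := (hγ k).differentiable
  have := integral_eq_of_hasDerivAt_off_countable_of_le (fun t => G (γ k t))
    (fun t => deriv (γ k) t • f (γ k t)) zero_le_one hs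
    (continuousOn_comp_curve hγ (fun w hw => (hG w hw).continuousAt.continuousWithinAt) k)
    (fun t ht => (hG _ (mem_cycleSupport γ k (Ioo_subset_Icc_self ht.1))).scomp t
      (hd t ht).hasDerivAt) (cycle_intervalIntegrable hγ hf k)
  rw [this, (hγ k).closed, sub_self]

/-- Differentiation under the integral sign. By compactness of the cycle, the kernel stays
nonsingular for `z` in a small closed ball, and there its `z`-derivative is uniformly bounded, which
supplies the dominating function. -/
theorem differentiableAt_cauchyTransform [CompleteSpace E] {f : ℂ → E}
    (hf : ContinuousOn f (cycleSupport γ)) {z₀ : ℂ} (hz₀ : ∀ w ∈ cycleSupport γ, w ^ 2 ≠ z₀ ^ 2) :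
    DifferentiableAt ℂ (fun z => cycleIntegral γ fun w => (w ^ 2 - z ^ 2)⁻¹ • f w) z₀ := by
  have hS := isCompact_cycleSupport hγ
  obtain ⟨r, hr, hne⟩ : ∃ r > 0, ∀ w ∈ cycleSupport γ, ∀ z ∈ Metric.closedBall z₀ r,
      w ^ 2 - z ^ 2 ≠ 0 := by
    have ho : IsOpen {p : ℂ × ℂ | p.1 ^ 2 - p.2 ^ 2 ≠ 0} :=
      isOpen_ne_fun (by fun_prop) (by fun_prop)
    obtain ⟨u, v, -, hv, hu, hzv, huv⟩ := generalized_tube_lemma hS (isCompact_singleton (x := z₀)) ho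
      (by
        rintro ⟨w, z⟩ ⟨hw, hz⟩
        obtain rfl : z = z₀ := hz
        exact sub_ne_zero.2 (hz₀ w hw))
    obtain ⟨r, hr, hrv⟩ := Metric.nhds_basis_closedBall.mem_iff.1
      (hv.mem_nhds (hzv rfl))
    exact ⟨r, hr, fun w hw z hz => huv (mk_mem_prod (hu hw) (hrv hz))⟩
  obtain ⟨M, hM⟩ := (hS.prod (isCompact_closedBall z₀ r)).exists_bound_of_continuousOn
    (f := fun p : ℂ × ℂ => (2 * p.2 / (p.1 ^ 2 - p.2 ^ 2) ^ 2) • f p.1) (by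
      refine ContinuousOn.smul (ContinuousOn.div (by fun_prop) (by fun_prop) ?_)
        (hf.comp continuousOn_fst fun p hp => hp.1)
      rintro ⟨w, z⟩ ⟨hw, hz⟩
      exact pow_ne_zero 2 (hne w hw z hz))
  have hz₀' : z₀ ∈ Metric.closedBall z₀ r := Metric.mem_closedBall_self hr.le
  have hcont : ∀ z ∈ Metric.closedBall z₀ r,
      ContinuousOn (fun w => (w ^ 2 - z ^ 2)⁻¹ • f w) (cycleSupport γ) := fun z hz =>
    ContinuousOn.smul (ContinuousOn.inv₀ (by fun_prop) fun w hw => hne w hw z hz) hf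
  have hcont' : ContinuousOn (fun w => (2 * z₀ / (w ^ 2 - z₀ ^ 2) ^ 2) • f w)
      (cycleSupport γ) :=
    ContinuousOn.smul (ContinuousOn.div (by fun_prop) (by fun_prop)
      fun w hw => pow_ne_zero 2 (hne w hw z₀ hz₀')) hf
  have hmem : ∀ k, ∀ t ∈ uIoc (0 : ℝ) 1, γ k t ∈ cycleSupport γ := by
    intro k t ht
    rw [uIoc_of_le zero_le_one] at ht
    exact mem_cycleSupport γ k (Ioc_subset_Icc_self ht)
  unfold cycleIntegral
  refine DifferentiableAt.fun_sum fun k _ => ?_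
  refine (intervalIntegral.hasDerivAt_integral_of_dominated_loc_of_deriv_le
    (F := fun z t => deriv (γ k) t • (γ k t ^ 2 - z ^ 2)⁻¹ • f (γ k t))
    (F' := fun z t => deriv (γ k) t • (2 * z / (γ k t ^ 2 - z ^ 2) ^ 2) • f (γ k t))
    (bound := fun t => ‖deriv (γ k) t‖ * M)
    (Metric.closedBall_mem_nhds z₀ hr) ?_ ?_ ?_ ?_ ?_ ?_).2.differentiableAt
  · filter_upwards [Metric.closedBall_mem_nhds z₀ hr] with z hz
    exact (cycle_intervalIntegrable hγ (hcont z hz) k).aestronglyMeasurable_restrict_uIoc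
  · exact cycle_intervalIntegrable hγ (hcont z₀ hz₀') k
  · exact (cycle_intervalIntegrable hγ hcont' k).aestronglyMeasurable_restrict_uIoc
  · refine Filter.Eventually.of_forall fun t ht z hz => ?_
    rw [norm_smul]
    exact mul_le_mul_of_nonneg_left (hM (γ k t, z) ⟨hmem k t ht, hz⟩) (norm_nonneg _)
  · exact (hγ k).integrable.norm.mul_const M
  · refine Filter.Eventually.of_forall fun t ht z hz => ?_
    have h1 : HasDerivAt (fun z : ℂ => γ k t ^ 2 - z ^ 2) (-(2 * z)) z := by
      simpa using ((hasDerivAt_id z).pow 2).const_sub (γ k t ^ 2)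
    have h2 := (h1.inv (hne _ (hmem k t ht) z hz)).smul_const (f (γ k t))
    rw [neg_neg] at h2
    exact h2.const_smul (deriv (γ k) t)

end Cycle

/-! ### Spectral projections of an even resolvent -/

section Spectral

variable {A : Type*} [NormedRing A] [NormedAlgebra ℂ A] [CompleteSpace A] {B : A}

omit [CompleteSpace A] in
theorem resolvent_mul_resolvent {ζ η : ℂ} (hζ : ζ ∈ resolventSet ℂ B) (hη : η ∈ resolventSet ℂ B)
    (hne : η ≠ ζ) :
    resolvent B ζ * resolvent B η = (η - ζ)⁻¹ • resolvent B ζ - (η - ζ)⁻¹ • resolvent B η := by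
  have h1 : resolvent B ζ * (algebraMap ℂ A ζ - B) = 1 := Ring.inverse_mul_cancel _ hζ
  have h2 : (algebraMap ℂ A η - B) * resolvent B η = 1 := Ring.mul_inverse_cancel _ hη
  have h3 : (η - ζ) • (resolvent B ζ * resolvent B η) = resolvent B ζ - resolvent B η := by
    have : algebraMap ℂ A (η - ζ) = (algebraMap ℂ A η - B) - (algebraMap ℂ A ζ - B) := by
      rw [map_sub]; abel
    calc (η - ζ) • (resolvent B ζ * resolvent B η)
        = resolvent B ζ * algebraMap ℂ A (η - ζ) * resolvent B η := by
          rw [Algebra.algebraMap_eq_smul_one, mul_smul_comm, mul_one, smul_mul_assoc]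
      _ = resolvent B ζ * ((algebraMap ℂ A η - B) * resolvent B η)
          - resolvent B ζ * (algebraMap ℂ A ζ - B) * resolvent B η := by
          rw [this]; noncomm_ring
      _ = _ := by rw [h1, h2, mul_one, one_mul]
  rw [← smul_sub, ← h3, smul_smul, inv_mul_cancel₀ (sub_ne_zero.2 hne), one_smul]

theorem isOpen_sq_mem_resolventSet : IsOpen {z : ℂ | z ^ 2 ∈ resolventSet ℂ B} :=
  (spectrum.isOpen_resolventSet B).preimage (continuous_pow 2)

theorem differentiableAt_resolvent_sq {z : ℂ} (hz : z ^ 2 ∈ resolventSet ℂ B) :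
    DifferentiableAt ℂ (fun z : ℂ => resolvent B (z ^ 2)) z :=
  DifferentiableAt.comp (g := resolvent B) (f := fun z : ℂ => z ^ 2) z
    (spectrum.hasDerivAt_resolvent_const_left hz).differentiableAt (differentiableAt_pow 2)

/-- If `z ↦ (z² - B)⁻¹ X` extends holomorphically across the singularities of `(z² - B)⁻¹`, then
`X = 0`, by Liouville's theorem. -/
theorem eq_zero_of_resolvent_extension {X : A} {N : Set ℂ} (hN : IsOpen N)
    (hcover : ∀ z : ℂ, z ^ 2 ∈ spectrum ℂ B → z ∈ N) {F : ℂ → A} (hF : DifferentiableOn ℂ F N)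
    (hFX : ∀ z ∈ N, z ^ 2 ∈ resolventSet ℂ B → resolvent B (z ^ 2) * X = F z) : X = 0 := by
  classical
  -- The two formulas agree where both make sense, so `H` is entire; it tends to `0` at infinity
  -- with the resolvent.
  let H : ℂ → A := fun z => if z ∈ N then F z else resolvent B (z ^ 2) * X
  have hmem : ∀ z, z ∉ N → z ^ 2 ∈ resolventSet ℂ B := fun z hz => by
    by_contra h
    exact hz (hcover z h)
  have hres : ∀ z, z ^ 2 ∈ resolventSet ℂ B → H z = resolvent B (z ^ 2) * X := by
    intro z hz
    by_cases hzN : z ∈ N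
    · simp only [H, if_pos hzN, hFX z hzN hz]
    · simp only [H, if_neg hzN]
  have hd : Differentiable ℂ H := by
    intro z
    by_cases hz : z ∈ N
    · refine ((hF z hz).differentiableAt (hN.mem_nhds hz)).congr_of_eventuallyEq ?_
      filter_upwards [hN.mem_nhds hz] with w hw
      simp only [H, if_pos hw]
    · refine ((differentiableAt_resolvent_sq (hmem z hz)).mul_const X).congr_of_eventuallyEq ?_
      filter_upwards [isOpen_sq_mem_resolventSet.mem_nhds (hmem z hz)] with w hw
      exact hres w hw
  have hbig : ∀ᶠ z in Bornology.cobounded ℂ, (z : ℂ) ^ 2 ∈ resolventSet ℂ B :=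
    ((tendsto_pow_cobounded_cobounded (α := ℂ) two_ne_zero).eventually
      (Bornology.isBounded_def.1 (spectrum.isBounded (𝕜 := ℂ) B))).mono
        fun z hz => by simpa [spectrum] using hz
  have hlim : Filter.Tendsto H (Bornology.cobounded ℂ) (𝓝 0) := by
    have h1 : Filter.Tendsto (fun z : ℂ => resolvent B (z ^ 2) * X) (Bornology.cobounded ℂ)
        (𝓝 (0 * X)) :=
      ((spectrum.resolvent_tendsto_cobounded (𝕜 := ℂ) B).comp
        (tendsto_pow_cobounded_cobounded (α := ℂ) two_ne_zero)).mul_const X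
    rw [zero_mul] at h1
    refine h1.congr' ?_
    filter_upwards [hbig] with z hz
    exact (hres z hz).symm
  obtain ⟨z, hz⟩ := hbig.exists
  have h0 : H z = 0 := hd.apply_eq_of_tendsto_cocompact z (by
    rwa [← Metric.cobounded_eq_cocompact])
  rw [hres z hz] at h0
  have hu : (algebraMap ℂ A (z ^ 2) - B) * resolvent B (z ^ 2) = 1 := Ring.mul_inverse_cancel _ hz
  rw [← one_mul X, ← hu, mul_assoc, h0, mul_zero]

/-- `P` is the spectral projection of `B` belonging to the squares of the points of `N₁`, where the
points with squares in the spectrum are covered by the disjoint open sets `N₁` and `N₂`. -/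
def IsSpectralProjection (B : A) (N₁ N₂ : Set ℂ) (P : A) : Prop :=
  ∃ C : ℂ → A, DifferentiableOn ℂ C (N₁ ∪ N₂) ∧
    (∀ z ∈ N₁, z ^ 2 ∈ resolventSet ℂ B → resolvent B (z ^ 2) * (1 - P) = C z) ∧
    ∀ z ∈ N₂, z ^ 2 ∈ resolventSet ℂ B → resolvent B (z ^ 2) * P = - C z

variable {N₁ N₂ : Set ℂ}

/-- With the sign convention for `C`, both conditions give the same formula `R(z²)(P - P') = C' -
C`, so a single function extends `R(z²)(P - P')` across every singularity. -/
theorem IsSpectralProjection.unique (h₁ : IsOpen N₁) (h₂ : IsOpen N₂)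
    (hcover : ∀ z : ℂ, z ^ 2 ∈ spectrum ℂ B → z ∈ N₁ ∪ N₂) {P P' : A}
    (hP : IsSpectralProjection B N₁ N₂ P) (hP' : IsSpectralProjection B N₁ N₂ P') : P = P' := by
  obtain ⟨C, hC, hC1, hC2⟩ := hP
  obtain ⟨C', hC', hC1', hC2'⟩ := hP'
  rw [← sub_eq_zero]
  refine eq_zero_of_resolvent_extension (h₁.union h₂) hcover (hC'.sub hC) ?_
  rintro z (hz | hz) hzr
  · simp only [Pi.sub_apply, ← hC1 z hz hzr, ← hC1' z hz hzr]
    noncomm_ring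
  · rw [mul_sub, hC2 z hz hzr, hC2' z hz hzr, Pi.sub_apply]
    abel

/-- Apply the Liouville argument to `X = P(1 - P) = (1 - P)P`: near the inner singularities `R(z²)X
= C P`, near the outer ones `R(z²)X = -C (1 - P)`. Disjointness of `N₁` and `N₂` makes this
piecewise definition holomorphic. -/
theorem IsSpectralProjection.mul_self (h₁ : IsOpen N₁) (h₂ : IsOpen N₂)
    (hdisj : Disjoint N₁ N₂)
    (hcover : ∀ z : ℂ, z ^ 2 ∈ spectrum ℂ B → z ∈ N₁ ∪ N₂) {P : A}
    (hP : IsSpectralProjection B N₁ N₂ P) : P * P = P := by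
  classical
  obtain ⟨C, hC, hC1, hC2⟩ := hP
  have h0 : P * (1 - P) = 0 := by
    refine eq_zero_of_resolvent_extension (h₁.union h₂) hcover
      (F := fun z => if z ∈ N₁ then C z * P else -C z * (1 - P)) ?_ ?_
    · have hat : ∀ z ∈ N₁ ∪ N₂, DifferentiableAt ℂ C z := fun z hz =>
        (hC z hz).differentiableAt ((h₁.union h₂).mem_nhds hz)
      rintro z (hz | hz) <;> refine DifferentiableAt.differentiableWithinAt ?_
      · refine ((hat z (Or.inl hz)).mul_const P).congr_of_eventuallyEq ?_
        filter_upwards [h₁.mem_nhds hz] with w hw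
        rw [if_pos hw]
      · refine ((hat z (Or.inr hz)).neg.mul_const (1 - P)).congr_of_eventuallyEq ?_
        filter_upwards [h₂.mem_nhds hz] with w hw
        rw [if_neg (hdisj.notMem_of_mem_right hw)]
        rfl
    · rintro z (hz | hz) hzr
      · rw [if_pos hz, ← hC1 z hz hzr]
        noncomm_ring
      · rw [if_neg (hdisj.notMem_of_mem_right hz), ← hC2 z hz hzr, mul_assoc]
  rw [mul_sub, mul_one, sub_eq_zero] at h0
  exact h0.symm

omit [CompleteSpace A] in
-- A conjugate linear multiplicative `κ` fixing `B` carries `R(ζ)` to the resolvent at the conjugate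
-- of `ζ`. Reflecting twice, `z ↦ κ (C (conj z))` is again holomorphic and witnesses the property
-- for `κ P`.
theorem IsSpectralProjection.conj {κ : A →L[ℝ] A} (hmul : ∀ x y, κ (x * y) = κ x * κ y)
    (hone : κ 1 = 1) (hsmul : ∀ (c : ℂ) x, κ (c • x) = starRingEnd ℂ c • κ x) (hB : κ B = B)
    (h₁ : IsOpen N₁) (h₂ : IsOpen N₂)
    (hN₁ : ∀ z ∈ N₁, starRingEnd ℂ z ∈ N₁) (hN₂ : ∀ z ∈ N₂, starRingEnd ℂ z ∈ N₂) {P : A}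
    (hP : IsSpectralProjection B N₁ N₂ P) : IsSpectralProjection B N₁ N₂ (κ P) := by
  obtain ⟨C, hC, hC1, hC2⟩ := hP
  have hinv : ∀ z : ℂ, z ^ 2 ∈ resolventSet ℂ B → (starRingEnd ℂ z) ^ 2 ∈ resolventSet ℂ B ∧
      resolvent B (z ^ 2) = κ (resolvent B ((starRingEnd ℂ z) ^ 2)) := by
    intro z hz
    have hc : ∀ c : ℂ, κ (algebraMap ℂ A c - B) = algebraMap ℂ A (starRingEnd ℂ c) - B := by
      intro c
      rw [map_sub, hB, Algebra.algebraMap_eq_smul_one, hsmul, hone, Algebra.algebraMap_eq_smul_one]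
    have hunit : ∀ c : ℂ, c ∈ resolventSet ℂ B → starRingEnd ℂ c ∈ resolventSet ℂ B ∧
        κ (resolvent B c) = resolvent B (starRingEnd ℂ c) := by
      intro c hcr
      have e1 : (algebraMap ℂ A (starRingEnd ℂ c) - B) * κ (resolvent B c) = 1 := by
        rw [← hc, ← hmul, resolvent, Ring.mul_inverse_cancel _ hcr, hone]
      have e2 : κ (resolvent B c) * (algebraMap ℂ A (starRingEnd ℂ c) - B) = 1 := by
        rw [← hc, ← hmul, resolvent, Ring.inverse_mul_cancel _ hcr, hone]
      have hu : starRingEnd ℂ c ∈ resolventSet ℂ B := ⟨⟨_, _, e1, e2⟩, rfl⟩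
      refine ⟨hu, ?_⟩
      have e3 : resolvent B (starRingEnd ℂ c) * (algebraMap ℂ A (starRingEnd ℂ c) - B) = 1 :=
        Ring.inverse_mul_cancel _ hu
      exact (left_inv_eq_right_inv e3 e1).symm
    have h := hunit _ hz
    rw [map_pow] at h
    refine ⟨h.1, ?_⟩
    have h' := (hunit _ h.1).2
    rw [map_pow, starRingEnd_self_apply] at h'
    exact h'.symm
  refine ⟨fun z => κ (C (starRingEnd ℂ z)), ?_, ?_, ?_⟩
  · intro z hz
    have hz' : starRingEnd ℂ z ∈ N₁ ∪ N₂ := hz.imp (hN₁ z) (hN₂ z)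
    have hd := ((hC _ hz').differentiableAt ((h₁.union h₂).mem_nhds hz')).hasDerivAt
    refine DifferentiableAt.differentiableWithinAt (HasDerivAt.differentiableAt
      (f' := κ (deriv C (starRingEnd ℂ z))) ?_)
    -- Conjugate linearity sends difference quotients of `C` at `conj z` to those of the new
    -- function at `z`; continuity of `κ` passes to the limit.
    rw [hasDerivAt_iff_tendsto_slope] at hd ⊢
    have ht : Filter.Tendsto (starRingEnd ℂ) (𝓝[≠] z) (𝓝[≠] (starRingEnd ℂ z)) :=
      Complex.continuous_conj.continuousAt.continuousWithinAt.tendsto_nhdsWithin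
        fun w hw hwz => hw ((starRingEnd ℂ).injective hwz)
    refine ((κ.continuous.tendsto _).comp (hd.comp ht)).congr fun w => ?_
    simp only [Function.comp_apply, slope_def_module, hsmul, map_sub, map_inv₀,
      starRingEnd_self_apply]
  · intro z hz hzr
    obtain ⟨h1, h2⟩ := hinv z hzr
    simp only [h2, ← hC1 _ (hN₁ z hz) h1, hmul, map_sub, hone]
  · intro z hz hzr
    obtain ⟨h1, h2⟩ := hinv z hzr
    rw [h2, ← hmul, hC2 _ (hN₂ z hz) h1, map_neg]

/-! ### Cycle integrals as spectral projections. -/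

section Cycle

variable {m : ℕ} {γ : Fin m → ℝ → ℂ} (hγ : ∀ k, IsClosedCurve (γ k))
include hγ

omit hγ in
theorem continuousOn_resolvent_sq (hB : ∀ w ∈ cycleSupport γ, w ^ 2 ∈ resolventSet ℂ B) :
    ContinuousOn (fun w : ℂ => resolvent B (w ^ 2)) (cycleSupport γ) := fun w hw =>
  (differentiableAt_resolvent_sq (hB w hw)).continuousAt.continuousWithinAt

omit hγ [CompleteSpace A] in
theorem sq_smul_resolvent_sq {w : ℂ} (hw : w ^ 2 ∈ resolventSet ℂ B) :
    w ^ 2 • resolvent B (w ^ 2) = 1 + B * resolvent B (w ^ 2) := by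
  have h : (algebraMap ℂ A (w ^ 2) - B) * resolvent B (w ^ 2) = 1 := Ring.mul_inverse_cancel _ hw
  rw [sub_mul, ← Algebra.smul_def] at h
  rw [← h]; abel

/-- Splitting `w² R(w²) = 1 + B R(w²)` gives `w³ R(w²)² = w R(w²) + B (w R(w²)²)`, and the last
factor has a primitive near the cycle. -/
theorem cycleIntegral_pow_three_smul (hB : ∀ w ∈ cycleSupport γ, w ^ 2 ∈ resolventSet ℂ B) :
    cycleIntegral γ (fun w => w ^ 3 • resolvent B (w ^ 2) ^ 2) =
      cycleIntegral γ (fun w => w • resolvent B (w ^ 2)) := by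
  have hr := continuousOn_resolvent_sq hB
  have h1 : ContinuousOn (fun w : ℂ => w • resolvent B (w ^ 2)) (cycleSupport γ) :=
    continuousOn_id.smul hr
  have h2 : ContinuousOn (fun w : ℂ => w • resolvent B (w ^ 2) ^ 2) (cycleSupport γ) :=
    continuousOn_id.smul (hr.pow 2)
  have h3 : cycleIntegral γ (fun w => w • resolvent B (w ^ 2) ^ 2) = 0 := by
    -- The derivative of `R(w²)` is `-2w R(w²)²`, hence the factor `-1/2`.
    refine cycleIntegral_eq_zero_of_hasDerivAt hγ h2
      (G := fun w => (-(1 / 2 : ℂ)) • resolvent B (w ^ 2)) fun w hw => ?_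
    have := ((spectrum.hasDerivAt_resolvent_const_left (hB w hw)).scomp w (hasDerivAt_pow 2 w)).const_smul
      (-(1 / 2 : ℂ))
    refine this.congr_deriv ?_
    rw [smul_smul, smul_neg, ← neg_smul]
    congr 1
    push_cast
    ring
  have h4 := cycleIntegral_clm hγ (ContinuousLinearMap.mul ℂ A B) h2
  rw [h3, map_zero] at h4
  calc _ = cycleIntegral γ (fun w => w • resolvent B (w ^ 2) +
        ContinuousLinearMap.mul ℂ A B (w • resolvent B (w ^ 2) ^ 2)) := by
        refine cycleIntegral_congr fun w hw => ?_
        have e : w ^ 3 • resolvent B (w ^ 2) ^ 2 =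
            w • ((w ^ 2 • resolvent B (w ^ 2)) * resolvent B (w ^ 2)) := by
          rw [smul_mul_assoc, smul_smul, ← pow_two, ← pow_succ']
        rw [e, sq_smul_resolvent_sq (hB w hw), add_mul, one_mul, smul_add, mul_assoc,
          ContinuousLinearMap.mul_apply', mul_smul_comm, pow_two (resolvent B (w ^ 2))]
    _ = _ := by
        have h5 : ContinuousOn (fun w => ContinuousLinearMap.mul ℂ A B
            (w • resolvent B (w ^ 2) ^ 2)) (cycleSupport γ) :=
          (ContinuousLinearMap.mul ℂ A B).continuous.comp_continuousOn h2
        rw [cycleIntegral_add hγ h1 h5, h4, add_zero]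

theorem cycleIntegral_isSpectralProjection
    (hB : ∀ w ∈ cycleSupport γ, w ^ 2 ∈ resolventSet ℂ B)
    (hN₁ : ∀ z ∈ N₁, (∀ w ∈ cycleSupport γ, w ^ 2 ≠ z ^ 2) ∧
      ∑ k, windingNumber (γ k) z = 1 ∧ ∑ k, windingNumber (γ k) (-z) = 1)
    (hN₂ : ∀ z ∈ N₂, (∀ w ∈ cycleSupport γ, w ^ 2 ≠ z ^ 2) ∧
      ∑ k, windingNumber (γ k) z = 0 ∧ ∑ k, windingNumber (γ k) (-z) = 0) :
    IsSpectralProjection B N₁ N₂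
      ((2 * Real.pi * Complex.I : ℂ)⁻¹ • cycleIntegral γ (fun w => w • resolvent B (w ^ 2))) := by
  set c : ℂ := (2 * Real.pi * Complex.I : ℂ)⁻¹ with hc
  have hr := continuousOn_resolvent_sq hB
  have h1 : ContinuousOn (fun w : ℂ => w • resolvent B (w ^ 2)) (cycleSupport γ) :=
    continuousOn_id.smul hr
  -- Multiply the resolvent identity for `R(z²) R(w²)` by `w` and integrate. Since `w/(w² - z²) = ½
  -- (1/(w - z) + 1/(w + z))`, the coefficient of `R(z²)` is the mean of the winding numbers around
  -- `z` and `-z`: it is `1` on `N₁` and `0` on `N₂`. The remaining Cauchy transform is the function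
  -- `C`.
  have key : ∀ z : ℂ, z ^ 2 ∈ resolventSet ℂ B → (∀ w ∈ cycleSupport γ, w ^ 2 ≠ z ^ 2) →
      resolvent B (z ^ 2) * (c • cycleIntegral γ (fun w => w • resolvent B (w ^ 2))) =
      ((1 / 2 : ℂ) * (∑ k, windingNumber (γ k) z + ∑ k, windingNumber (γ k) (-z))) •
        resolvent B (z ^ 2) -
      c • cycleIntegral γ (fun w => (w ^ 2 - z ^ 2)⁻¹ • w • resolvent B (w ^ 2)) := by
    intro z hz hw
    have hne : ∀ w ∈ cycleSupport γ, w - z ≠ 0 := fun w h h0 =>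
      hw w h (by rw [sub_eq_zero.1 h0])
    have hne' : ∀ w ∈ cycleSupport γ, w - -z ≠ 0 := fun w h h0 =>
      hw w h (by rw [sub_eq_zero.1 h0, neg_sq])
    have hne2 : ∀ w ∈ cycleSupport γ, w ^ 2 - z ^ 2 ≠ 0 := fun w h => sub_ne_zero.2 (hw w h)
    have c1 : ContinuousOn (fun w : ℂ => (w - z)⁻¹) (cycleSupport γ) :=
      ContinuousOn.inv₀ (by fun_prop) hne
    have c2 : ContinuousOn (fun w : ℂ => (w - -z)⁻¹) (cycleSupport γ) :=
      ContinuousOn.inv₀ (by fun_prop) hne'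
    have c3 : ContinuousOn (fun w : ℂ => (w ^ 2 - z ^ 2)⁻¹ • w • resolvent B (w ^ 2))
        (cycleSupport γ) := (ContinuousOn.inv₀ (by fun_prop) hne2).smul h1
    have c4 : ContinuousOn (fun w : ℂ => (w - z)⁻¹ + (w - -z)⁻¹) (cycleSupport γ) := c1.add c2
    let L : ℂ →L[ℂ] A := (1 / 2 : ℂ) • (ContinuousLinearMap.id ℂ ℂ).smulRight (resolvent B (z ^ 2))
    have c5 : ContinuousOn (fun w : ℂ => L ((w - z)⁻¹ + (w - -z)⁻¹)) (cycleSupport γ) :=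
      L.continuous.comp_continuousOn c4
    have hwind : ∀ y : ℂ, ∑ k, windingNumber (γ k) y = c * cycleIntegral γ (fun w => (w - y)⁻¹) := by
      intro y
      simp only [windingNumber, cycleIntegral, ← Finset.mul_sum, ← hc, smul_eq_mul, div_eq_mul_inv]
    have e1 : resolvent B (z ^ 2) * cycleIntegral γ (fun w => w • resolvent B (w ^ 2)) =
        L (cycleIntegral γ (fun w => (w - z)⁻¹) + cycleIntegral γ (fun w => (w - -z)⁻¹)) -
        cycleIntegral γ (fun w => (w ^ 2 - z ^ 2)⁻¹ • w • resolvent B (w ^ 2)) := by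
      rw [← cycleIntegral_add hγ c1 c2, ← cycleIntegral_clm hγ L c4,
        ← cycleIntegral_sub hγ c5 c3]
      have := cycleIntegral_clm hγ (ContinuousLinearMap.mul ℂ A (resolvent B (z ^ 2))) h1
      rw [ContinuousLinearMap.mul_apply'] at this
      rw [← this]
      refine cycleIntegral_congr fun w hwS => ?_
      rw [ContinuousLinearMap.mul_apply', mul_smul_comm,
        resolvent_mul_resolvent hz (hB w hwS) (hw w hwS), smul_sub,
        smul_comm w (w ^ 2 - z ^ 2)⁻¹ (resolvent B (w ^ 2))]
      congr 1
      simp only [L, smul_apply, ContinuousLinearMap.smulRight_apply,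
        ContinuousLinearMap.id_apply, smul_smul]
      congr 1
      have a1 := hne w hwS
      have a2 := hne' w hwS
      have a3 := hne2 w hwS
      field_simp
      ring
    rw [mul_smul_comm, e1, smul_sub, hwind, hwind, ← mul_add]
    congr 1
    simp only [L, smul_apply, ContinuousLinearMap.smulRight_apply,
      ContinuousLinearMap.id_apply, smul_smul]
    congr 1
    ring
  refine ⟨fun z => c • cycleIntegral γ (fun w => (w ^ 2 - z ^ 2)⁻¹ • w • resolvent B (w ^ 2)),
    ?_, ?_, ?_⟩
  · intro z hz
    exact ((differentiableAt_cauchyTransform hγ h1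
      (hz.elim (fun h => (hN₁ z h).1) fun h => (hN₂ z h).1)).const_smul c).differentiableWithinAt
  · intro z hz hzr
    obtain ⟨hw, e1, e2⟩ := hN₁ z hz
    rw [mul_sub, key z hzr hw, e1, e2]
    norm_num
  · intro z hz hzr
    obtain ⟨hw, e1, e2⟩ := hN₂ z hz
    rw [key z hzr hw, e1, e2]
    simp

end Cycle

end Spectral

/-! ### Commuting elements with real spectra -/

/-- A character of a commutative Banach algebra containing the `T i` gives `z² = -∑ φ(T i)²` with
each `φ(T i)` real. So `z²` is real and nonpositive. -/
theorem re_eq_zero_of_sq_mem_spectrum {A : Type*} [NormedRing A] [NormedAlgebra ℂ A]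
    [CompleteSpace A] {ι : Type*} [Fintype ι] (T : ι → A) (hcomm : ∀ i j, Commute (T i) (T j))
    (hreal : ∀ i, ∀ z ∈ spectrum ℂ (T i), z.im = 0) {z : ℂ}
    (hz : z ^ 2 ∈ spectrum ℂ (-∑ i, T i ^ 2)) : z.re = 0 := by
  -- The bicommutant is closed, commutative, and contains the inverses of its elements that are
  -- invertible in `A`; so passing to it does not enlarge spectra.
  let M : Subalgebra ℂ A := Subalgebra.centralizer ℂ (Set.centralizer (range T))
  have hTM : ∀ i, T i ∈ M := fun i => Set.subset_centralizer_centralizer ⟨i, rfl⟩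
  have hMcomm : ∀ x y : M, x * y = y * x := fun x y => Subtype.ext
    (Set.centralizer_centralizer_comm_of_comm (S := range T)
      (by rintro _ ⟨i, rfl⟩ _ ⟨j, rfl⟩; exact hcomm i j) _ x.2 _ y.2)
  let _ : NormedCommRing M := { (inferInstance : NormedRing M) with mul_comm := hMcomm }
  have : CompleteSpace M := IsClosed.completeSpace_coe
    (s := Set.centralizer (Set.centralizer (range T))) (hs := Set.isClosed_centralizer _)
  let t : ι → M := fun i => ⟨T i, hTM i⟩
  have hnu : ¬ IsUnit (algebraMap ℂ M (z ^ 2) + ∑ i, t i ^ 2) := by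
    intro hu
    refine hz ?_
    have := hu.map M.val
    rw [map_add, map_sum] at this
    change IsUnit (algebraMap ℂ A (z ^ 2) - -∑ i, T i ^ 2)
    rw [sub_neg_eq_add]
    exact this
  obtain ⟨φ, hφ⟩ := WeakDual.CharacterSpace.exists_apply_eq_zero hnu
  have hφt : ∀ i, (φ (t i)).im = 0 := by
    intro i
    refine hreal i _ fun hu => ?_
    have hmem : ∀ x ∈ M, IsUnit x → ∃ y ∈ M, x * y = 1 := by
      rintro _ hx ⟨x, rfl⟩
      refine ⟨((x⁻¹ : Aˣ) : A), ?_, x.mul_inv⟩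
      intro m hm
      exact (Commute.units_inv_right (hx m hm : Commute m (x : A)))
    obtain ⟨y, hy, hxy⟩ := hmem _ (M.sub_mem (M.algebraMap_mem _) (hTM i)) hu
    have h1 : (algebraMap ℂ M (φ (t i)) - t i) * ⟨y, hy⟩ = 1 := Subtype.ext hxy
    have h2 := congrArg φ h1
    rw [map_mul, map_sub, AlgHomClass.commutes, Algebra.algebraMap_self, RingHom.id_apply,
      sub_self, zero_mul, map_one] at h2
    exact zero_ne_one h2
  rw [map_add, map_sum, AlgHomClass.commutes, Algebra.algebraMap_self, RingHom.id_apply] at hφ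
  have hsq : ∀ i, φ (t i ^ 2) = (((φ (t i)).re ^ 2 : ℝ) : ℂ) := by
    intro i
    rw [map_pow]
    conv_lhs => rw [← Complex.re_add_im (φ (t i)), hφt i]
    simp
  simp only [hsq, ← Complex.ofReal_sum] at hφ
  have hre := congrArg Complex.re hφ
  have him := congrArg Complex.im hφ
  simp [pow_two] at hre him
  have hnn : 0 ≤ ∑ i, (φ (t i)).re * (φ (t i)).re :=
    Finset.sum_nonneg fun i _ => mul_self_nonneg _
  -- If `z.re ≠ 0`, then `z²` being real forces `z.im = 0`, so `z² > 0`, which contradicts `hre`.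
  by_contra hne
  have : z.im = 0 := by
    have : 2 * z.re * z.im = 0 := by linarith
    simpa [hne] using this
  rw [this] at hre
  have := mul_self_pos.2 hne
  linarith

/-! ### The complexification of a real Banach space -/

section Complexify

variable (V : Type u) [NormedAddCommGroup V] [NormedSpace ℝ V]

/-- The complexification of `V`, realized as the real linear maps `ℂ → V` so that its norm is
compatible with the action of `ℂ`; the map `f` stands for `f 1 - i f i`. -/
def Complexify : Type u := ℂ →L[ℝ] V

instance : NormedAddCommGroup (Complexify V) := inferInstanceAs (NormedAddCommGroup (ℂ →L[ℝ] V))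

instance [CompleteSpace V] : CompleteSpace (Complexify V) :=
  inferInstanceAs (CompleteSpace (ℂ →L[ℝ] V))

namespace Complexify

variable {V}

/-- The complexification as a space of maps. -/
def toMap : Complexify V ≃+ (ℂ →L[ℝ] V) := AddEquiv.refl _

theorem norm_toMap (f : Complexify V) : ‖toMap f‖ = ‖f‖ := rfl

instance : SMul ℂ (Complexify V) :=
  ⟨fun c f => toMap.symm ((toMap f).comp (ContinuousLinearMap.mul ℝ ℂ c))⟩

theorem smul_toMap (c : ℂ) (f : Complexify V) (w : ℂ) : toMap (c • f) w = toMap f (c * w) := rfl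

theorem ext_toMap {f g : Complexify V} (h : ∀ w, toMap f w = toMap g w) : f = g :=
  toMap.injective (ContinuousLinearMap.ext h)

instance : Module ℂ (Complexify V) where
  one_smul f := ext_toMap fun w => by rw [smul_toMap, one_mul]
  mul_smul c d f := ext_toMap fun w => by simp only [smul_toMap]; congr 1; ring
  smul_zero c := ext_toMap fun w => by simp [smul_toMap]
  smul_add c f g := ext_toMap fun w => by simp [smul_toMap]
  add_smul c d f := ext_toMap fun w => by simp [smul_toMap, add_mul]
  zero_smul f := ext_toMap fun w => by simp [smul_toMap]

instance : NormedSpace ℂ (Complexify V) where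
  norm_smul_le c f := by
    rw [← norm_toMap]
    refine ContinuousLinearMap.opNorm_le_bound _ (by positivity) fun w => ?_
    rw [smul_toMap]
    refine ((toMap f).le_opNorm _).trans_eq ?_
    rw [norm_mul, norm_toMap]
    ring

theorem real_smul_toMap (r : ℝ) (f : Complexify V) (w : ℂ) : toMap (r • f) w = r • toMap f w := by
  change toMap f ((r : ℂ) * w) = _
  rw [← map_smul, Complex.real_smul]

/-- Evaluation of an element of the complexification. -/
def evalAt (w : ℂ) : Complexify V →L[ℝ] V :=
  LinearMap.mkContinuous
    { toFun := fun f => toMap f w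
      map_add' := fun f g => by simp
      map_smul' := fun r f => real_smul_toMap r f w } ‖w‖ fun f => by
    rw [mul_comm]
    exact (toMap f).le_opNorm w

/-- The inclusion of a real Banach space in its complexification. -/
def incl : V →L[ℝ] Complexify V :=
  LinearMap.mkContinuous
    { toFun := fun v => toMap.symm (Complex.reCLM.smulRight v)
      map_add' := fun v v' => ext_toMap fun w => by simp
      map_smul' := fun r v => ext_toMap fun w => by
        rw [RingHom.id_apply, real_smul_toMap]
        simp [smul_comm r] } 1 fun v => by
    refine ContinuousLinearMap.opNorm_le_bound _ (by positivity) fun w => ?_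
    change ‖w.re • v‖ ≤ _
    rw [norm_smul, one_mul, mul_comm]
    exact mul_le_mul_of_nonneg_left (Complex.abs_re_le_norm w) (norm_nonneg v)

theorem toMap_incl (v : V) (w : ℂ) : toMap (incl v) w = w.re • v := rfl

theorem eq_incl_sub (f : Complexify V) :
    f = incl (toMap f 1) - Complex.I • incl (toMap f Complex.I) := by
  refine ext_toMap fun w => ?_
  rw [map_sub, sub_apply, smul_toMap, toMap_incl, toMap_incl, Complex.I_mul_re, neg_smul,
    sub_neg_eq_add, ← map_smul, ← map_smul, ← map_add]
  congr 1
  simp only [Complex.real_smul, mul_one]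
  exact (Complex.re_add_im w).symm

theorem op_ext {X Y : Complexify V →L[ℂ] Complexify V} (h : ∀ v, X (incl v) = Y (incl v)) :
    X = Y := by
  ext f
  rw [eq_incl_sub f]
  simp only [map_sub, map_smul, h]

/-- The complex linear extension of a real linear operator. -/
def extendOp (A : V →L[ℝ] V) : Complexify V →L[ℂ] Complexify V :=
  LinearMap.mkContinuous
    { toFun := fun f => toMap.symm (A.comp (toMap f))
      map_add' := fun f g => ext_toMap fun w => by simp
      map_smul' := fun c f => ext_toMap fun w => by simp [smul_toMap] } ‖A‖
    fun f => A.opNorm_comp_le (toMap f)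

theorem toMap_extendOp (A : V →L[ℝ] V) (f : Complexify V) (w : ℂ) :
    toMap (extendOp A f) w = A (toMap f w) := rfl

/-- The complex linear extension of real linear operators, as a morphism of algebras. -/
def extendHom : (V →L[ℝ] V) →ₐ[ℝ] (Complexify V →L[ℂ] Complexify V) :=
  AlgHom.ofLinearMap
    { toFun := extendOp
      map_add' := fun A B => ContinuousLinearMap.ext fun f => ext_toMap fun w => by
        simp [toMap_extendOp]
      map_smul' := fun r A => ContinuousLinearMap.ext fun f => ext_toMap fun w => by
        simp [toMap_extendOp, real_smul_toMap] }
    (ContinuousLinearMap.ext fun f => ext_toMap fun w => by simp [toMap_extendOp])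
    (fun A B => ContinuousLinearMap.ext fun f => ext_toMap fun w => by simp [toMap_extendOp])

theorem extendHom_incl (A : V →L[ℝ] V) (v : V) : extendHom A (incl v) = incl (A v) :=
  ext_toMap fun w => by
    change A (w.re • v) = w.re • A v
    rw [map_smul]

theorem norm_extendHom_le (A : V →L[ℝ] V) : ‖extendHom A‖ ≤ ‖A‖ :=
  LinearMap.mkContinuous_norm_le _ (norm_nonneg A) fun f => A.opNorm_comp_le (toMap f)

variable (V) in
/-- `extendHom` as a continuous linear map. -/
def extendL : (V →L[ℝ] V) →L[ℝ] (Complexify V →L[ℂ] Complexify V) :=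
  LinearMap.mkContinuous extendHom.toLinearMap 1 fun A => by
    rw [one_mul]; exact norm_extendHom_le A

/-- The compression `v ↦ (X v)(w)` of a complex linear operator. -/
def compress (w : ℂ) : (Complexify V →L[ℂ] Complexify V) →L[ℝ] (V →L[ℝ] V) :=
  LinearMap.mkContinuous
    { toFun := fun X => (evalAt w).comp ((X.restrictScalars ℝ).comp incl)
      map_add' := fun X Y => by ext v; simp
      map_smul' := fun r X => by ext v; simp } (‖evalAt (V := V) w‖ * ‖incl (V := V)‖) fun X => by
    refine (ContinuousLinearMap.opNorm_comp_le _ _).trans ?_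
    refine (mul_le_mul_of_nonneg_left (ContinuousLinearMap.opNorm_comp_le _ _)
      (norm_nonneg _)).trans_eq ?_
    rw [ContinuousLinearMap.norm_restrictScalars]
    ring

variable (V) in
/-- The real part of a complex linear operator. -/
def rePart : (Complexify V →L[ℂ] Complexify V) →L[ℝ] (V →L[ℝ] V) := compress 1

variable (V) in
/-- The imaginary part of a complex linear operator. -/
def imPart : (Complexify V →L[ℂ] Complexify V) →L[ℝ] (V →L[ℝ] V) := -compress Complex.I

theorem rePart_apply (X : Complexify V →L[ℂ] Complexify V) (v : V) :
    rePart V X v = toMap (X (incl v)) 1 := rfl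

theorem imPart_apply (X : Complexify V →L[ℂ] Complexify V) (v : V) :
    imPart V X v = -toMap (X (incl v)) Complex.I := rfl

theorem extendHom_rePart_add (X : Complexify V →L[ℂ] Complexify V) :
    extendHom (rePart V X) + Complex.I • extendHom (imPart V X) = X := by
  refine op_ext fun v => ?_
  rw [add_apply, smul_apply, extendHom_incl, extendHom_incl]
  conv_rhs => rw [eq_incl_sub (X (incl v))]
  rw [sub_eq_add_neg, ← smul_neg, ← map_neg]
  rfl

theorem rePart_extendHom (A : V →L[ℝ] V) : rePart V (extendHom A) = A := by
  ext v
  rw [rePart_apply, extendHom_incl, toMap_incl, Complex.one_re, one_smul]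

theorem imPart_extendHom (A : V →L[ℝ] V) : imPart V (extendHom A) = 0 := by
  ext v
  rw [imPart_apply, extendHom_incl, toMap_incl, Complex.I_re, zero_smul, neg_zero]
  rfl

theorem rePart_I_smul (X : Complexify V →L[ℂ] Complexify V) :
    rePart V (Complex.I • X) = -imPart V X := by
  ext v
  rw [rePart_apply, neg_apply, imPart_apply, neg_neg, smul_apply, smul_toMap, mul_one]

theorem imPart_I_smul (X : Complexify V →L[ℂ] Complexify V) :
    imPart V (Complex.I • X) = rePart V X := by
  ext v
  rw [rePart_apply, imPart_apply, smul_apply, smul_toMap,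
    Complex.I_mul_I, map_neg, neg_neg]

theorem I_smul_I_smul (X : Complexify V →L[ℂ] Complexify V) :
    Complex.I • Complex.I • X = -X := by
  rw [smul_smul, Complex.I_mul_I, neg_one_smul]

theorem I_smul_mul_I_smul (X Y : Complexify V →L[ℂ] Complexify V) :
    (Complex.I • X) * (Complex.I • Y) = -(X * Y) := by
  rw [smul_mul_smul_comm, Complex.I_mul_I, neg_one_smul]

theorem mul_eq (X Y : Complexify V →L[ℂ] Complexify V) :
    X * Y = extendHom (rePart V X * rePart V Y - imPart V X * imPart V Y) +
      Complex.I • extendHom (rePart V X * imPart V Y + imPart V X * rePart V Y) := by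
  conv_lhs => rw [← extendHom_rePart_add X, ← extendHom_rePart_add Y]
  rw [add_mul, mul_add, mul_add, I_smul_mul_I_smul, map_sub, map_add, map_mul, map_mul, map_mul,
    map_mul, smul_add, mul_smul_comm, smul_mul_assoc]
  abel

theorem rePart_mul (X Y : Complexify V →L[ℂ] Complexify V) :
    rePart V (X * Y) = rePart V X * rePart V Y - imPart V X * imPart V Y := by
  rw [mul_eq, map_add, rePart_extendHom, rePart_I_smul, imPart_extendHom, neg_zero, add_zero]

theorem imPart_mul (X Y : Complexify V →L[ℂ] Complexify V) :
    imPart V (X * Y) = rePart V X * imPart V Y + imPart V X * rePart V Y := by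
  rw [mul_eq, map_add, imPart_extendHom, imPart_I_smul, rePart_extendHom, zero_add]

theorem smul_eq (c : ℂ) (X : Complexify V →L[ℂ] Complexify V) :
    c • X = c.re • X + Complex.I • (c.im • X) := by
  conv_lhs => rw [← Complex.re_add_im c, add_smul, mul_comm, mul_smul]
  rfl

theorem rePart_smul (c : ℂ) (X : Complexify V →L[ℂ] Complexify V) :
    rePart V (c • X) = c.re • rePart V X - c.im • imPart V X := by
  rw [smul_eq, map_add, rePart_I_smul, map_smul, map_smul, sub_eq_add_neg]

theorem imPart_smul (c : ℂ) (X : Complexify V →L[ℂ] Complexify V) :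
    imPart V (c • X) = c.re • imPart V X + c.im • rePart V X := by
  rw [smul_eq, map_add, imPart_I_smul, map_smul, map_smul]

variable (V) in
/-- Complex conjugation of operators on the complexification. -/
def conjOp : (Complexify V →L[ℂ] Complexify V) →L[ℝ] (Complexify V →L[ℂ] Complexify V) :=
  (extendL V).comp (rePart V) -
    (Complex.I • ContinuousLinearMap.id ℝ (Complexify V →L[ℂ] Complexify V)).comp
      ((extendL V).comp (imPart V))

theorem conjOp_apply (X : Complexify V →L[ℂ] Complexify V) :
    conjOp V X = extendHom (rePart V X) - Complex.I • extendHom (imPart V X) := rfl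

theorem conjOp_extendHom (A : V →L[ℝ] V) : conjOp V (extendHom A) = extendHom A := by
  rw [conjOp_apply, rePart_extendHom, imPart_extendHom, map_zero, smul_zero, sub_zero]

theorem conjOp_mul (X Y : Complexify V →L[ℂ] Complexify V) :
    conjOp V (X * Y) = conjOp V X * conjOp V Y := by
  simp only [conjOp_apply, rePart_mul, imPart_mul, map_sub, map_add, map_mul, sub_mul, mul_sub,
    smul_add, mul_smul_comm, smul_mul_assoc, smul_sub, I_smul_I_smul]
  abel

theorem conjOp_smul (c : ℂ) (X : Complexify V →L[ℂ] Complexify V) :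
    conjOp V (c • X) = starRingEnd ℂ c • conjOp V X := by
  rw [smul_eq (starRingEnd ℂ c)]
  simp only [conjOp_apply, rePart_smul, imPart_smul, map_sub, map_add, map_smul, Complex.conj_re,
    Complex.conj_im, smul_sub, smul_add, neg_smul, smul_neg, smul_smul, smul_comm _ Complex.I]
  rw [Complex.I_mul_I, neg_one_smul]
  abel

/-- Conjugation changes the sign of the imaginary part. This is what later removes `I` from the
image of the projection. -/
theorem imPart_eq_zero_of_conjOp_eq {X : Complexify V →L[ℂ] Complexify V}
    (h : conjOp V X = X) : imPart V X = 0 := by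
  have h' := congrArg (imPart V) h
  rw [conjOp_apply, map_sub, imPart_extendHom, imPart_I_smul, rePart_extendHom, zero_sub] at h'
  ext v
  have h2 : -(imPart V X v) = imPart V X v := DFunLike.congr_fun h' v
  have h3 : (2 : ℝ) • imPart V X v = 0 := by
    rw [two_smul]
    nth_rewrite 1 [← h2]
    exact neg_add_cancel _
  simpa using h3

end Complexify

end Complexify

/-! ### The slice morphisms `x + i y ↦ x + I y` -/

section SliceHom

variable {V : Type u} [NormedAddCommGroup V] [NormedSpace ℝ V]

/-! Shortcut instances, which keep instance search in `𝓑(V₅)` short. -/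

scoped instance (priority := high) instNormedRingCliffordOp : NormedRing (CliffordOp V) :=
  inferInstance

scoped instance (priority := high) instNormedAlgebraCliffordOp : NormedAlgebra ℝ (CliffordOp V) :=
  inferInstance

scoped instance (priority := high) instRingCliffordOp : Ring (CliffordOp V) := Subalgebra.toRing _

scoped instance (priority := high) instAddCommGroupCliffordOp : AddCommGroup (CliffordOp V) :=
  Ring.toAddCommGroup

scoped instance (priority := high) instAddGroupCliffordOp : AddGroup (CliffordOp V) :=
  AddCommGroup.toAddGroup

scoped instance (priority := high) instNonUnitalNonAssocRingCliffordOp :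
    NonUnitalNonAssocRing (CliffordOp V) := inferInstance

scoped instance (priority := high) instSubtractionCommMonoidCliffordOp :
    SubtractionCommMonoid (CliffordOp V) := inferInstance

scoped instance (priority := high) instSubtractionMonoidCliffordOp :
    SubtractionMonoid (CliffordOp V) := inferInstance

scoped instance (priority := high) instSubNegMonoidCliffordOp : SubNegMonoid (CliffordOp V) :=
  inferInstance

scoped instance (priority := high) instSubNegZeroMonoidCliffordOp : SubNegZeroMonoid (CliffordOp V) :=
  inferInstance

scoped instance (priority := high) instInvolutiveNegCliffordOp : InvolutiveNeg (CliffordOp V) :=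
  inferInstance

variable (V) in
/-- `ofComponent` as a morphism of algebras. -/
def componentHom : (V →L[ℝ] V) →ₐ[ℝ] CliffordOp V :=
  AlgHom.ofLinearMap
    { toFun := ofComponent
      map_add' := fun A B => Subtype.ext (by ext v C; simp [ofComponent])
      map_smul' := fun r A => Subtype.ext (by ext v C; simp [ofComponent]) }
    (Subtype.ext (by ext v C; simp [ofComponent]))
    (fun A B => Subtype.ext (by ext v C; simp [ofComponent]))

theorem componentHom_apply (A : V →L[ℝ] V) : componentHom V A = ofComponent A := rfl

theorem coe_ofComponent_apply (A : V →L[ℝ] V) (v : CliffordModule V) (C : Finset (Fin 5)) :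
    (ofComponent A : CliffordModule V →L[ℝ] CliffordModule V) v C = A (v C) := rfl

variable (V) in
/-- `ofComponent` as a continuous linear map. -/
def componentL : (V →L[ℝ] V) →L[ℝ] CliffordOp V :=
  LinearMap.mkContinuous (componentHom V).toLinearMap 1 fun A => by
    rw [one_mul]
    refine ContinuousLinearMap.opNorm_le_bound _ (norm_nonneg A) fun v => ?_
    refine (pi_norm_le_iff_of_nonneg (by positivity)).2 fun C => ?_
    change ‖A (v C)‖ ≤ _
    exact (A.le_opNorm _).trans (mul_le_mul_of_nonneg_left (norm_le_pi_norm v C) (norm_nonneg A))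

theorem commute_e_ofComponent (i : Fin 5) (A : V →L[ℝ] V) :
    Commute (e i : CliffordOp V) (ofComponent A) := by
  refine Subtype.ext ?_
  ext v C
  simp [e, leftMul, coe_ofComponent_apply]

/-- `(∑ e_i a_i)² = -∑ a_i²` for commuting `a_i` which commute with the units. -/
theorem sum_e_mul_mul_self (a : Fin 5 → CliffordOp V) (ha : ∀ i j, Commute (a i) (a j))
    (he : ∀ i j, Commute (e i) (a j)) :
    (∑ i, e i * a i) * (∑ i, e i * a i) = -∑ i, a i * a i := by
  have hf : ∀ i j, (e i * a i) * (e j * a j) = (e i * e j) * (a i * a j) := fun i j => by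
    rw [mul_assoc, ← mul_assoc (a i), ← (he j i).eq]; noncomm_ring
  have h1 : (∑ i, e i * a i) * (∑ i, e i * a i) = ∑ i, ∑ j, (e i * e j) * (a i * a j) := by
    simp only [Finset.sum_mul_sum, hf]
  have h2 : ∑ i, ∑ j, (e i * e j) * (a i * a j) = ∑ i, ∑ j, (e j * e i) * (a i * a j) := by
    rw [Finset.sum_comm]
    refine Finset.sum_congr rfl fun i _ => Finset.sum_congr rfl fun j _ => ?_
    rw [(ha i j).eq]
  -- The double sum is added to its transpose: anticommutation cancels the terms with `i ≠ j`, and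
  -- the diagonal is counted twice.
  have h3 : ∀ i, ∑ j, ((e i * e j) * (a i * a j) + (e j * e i) * (a i * a j)) =
      -((2 : ℝ) • (a i * a i)) := by
    intro i
    rw [Finset.sum_eq_single i]
    · rw [e_mul_self, two_smul, neg_one_mul, neg_add]
    · intro j _ hji
      rw [e_mul_e j i hji, neg_mul, add_neg_cancel]
    · exact fun h => absurd (Finset.mem_univ i) h
  have h4 : (2 : ℝ) • ((∑ i, e i * a i) * (∑ i, e i * a i)) = (2 : ℝ) • -∑ i, a i * a i := by
    rw [two_smul]
    nth_rewrite 2 [h1]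
    rw [h2, h1, ← Finset.sum_add_distrib]
    simp only [← Finset.sum_add_distrib, h3]
    rw [Finset.sum_neg_distrib, ← Finset.smul_sum, smul_neg]
  exact smul_right_injective _ (two_ne_zero (α := ℝ)) h4

variable (V) in
/-- The imaginary unit `I = ∑ I_i e_i`. -/
def imagUnit (I : EuclideanSpace ℝ (Fin 5)) : CliffordOp V := ∑ i, e i * I i • (1 : CliffordOp V)

theorem para_slicePoint (I : EuclideanSpace ℝ (Fin 5)) (z : ℂ) :
    (para (slicePoint I z) : CliffordOp V) = z.re • 1 + z.im • imagUnit V I := by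
  simp [para, slicePoint, imagUnit, Finset.smul_sum, smul_smul]

theorem imagUnit_mul_self {I : EuclideanSpace ℝ (Fin 5)} (hI : I ∈ unitSphere) :
    imagUnit V I * imagUnit V I = -1 := by
  rw [imagUnit, sum_e_mul_mul_self _ (fun i j => ((Commute.one_left _).smul_left _).smul_right _)
    fun i j => (Commute.one_right _).smul_right _]
  have h : ∑ i, I i * I i = 1 := by
    have h1 : ‖I‖ = 1 := by simpa [unitSphere] using hI
    have h2 := EuclideanSpace.real_norm_sq_eq I
    rw [h1] at h2
    simp only [← pow_two, ← h2, one_pow]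
  simp only [smul_mul_smul_comm, mul_one, ← Finset.sum_smul, h, one_smul]

theorem commute_imagUnit_ofComponent (I : EuclideanSpace ℝ (Fin 5)) (A : V →L[ℝ] V) :
    Commute (imagUnit V I) (ofComponent A) :=
  Commute.sum_left _ _ _ fun i _ =>
    (commute_e_ofComponent i A).mul_left ((Commute.one_left _).smul_left _)

open Complexify

variable (V) in
/-- The map `X + i Y ↦ X + I Y`. -/
def sliceMap (I : EuclideanSpace ℝ (Fin 5)) :
    (Complexify V →L[ℂ] Complexify V) →L[ℝ] CliffordOp V :=
  (componentL V).comp (rePart V) +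
    (ContinuousLinearMap.mul ℝ (CliffordOp V) (imagUnit V I)).comp ((componentL V).comp (imPart V))

theorem sliceMap_apply (I : EuclideanSpace ℝ (Fin 5)) (X : Complexify V →L[ℂ] Complexify V) :
    sliceMap V I X = ofComponent (rePart V X) + imagUnit V I * ofComponent (imPart V X) := rfl

theorem sliceMap_extendHom (I : EuclideanSpace ℝ (Fin 5)) (A : V →L[ℝ] V) :
    sliceMap V I (extendHom A) = ofComponent A := by
  rw [sliceMap_apply, rePart_extendHom, imPart_extendHom, ← componentHom_apply 0, map_zero, mul_zero,
    add_zero]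

theorem sliceMap_one (I : EuclideanSpace ℝ (Fin 5)) : sliceMap V I 1 = 1 := by
  rw [← map_one (extendHom (V := V)), sliceMap_extendHom, ← componentHom_apply, map_one]

theorem sliceMap_mul {I : EuclideanSpace ℝ (Fin 5)} (hI : I ∈ unitSphere)
    (X Y : Complexify V →L[ℂ] Complexify V) :
    sliceMap V I (X * Y) = sliceMap V I X * sliceMap V I Y := by
  have h1 := commute_imagUnit_ofComponent I (rePart V X)
  have h2 := commute_imagUnit_ofComponent I (imPart V X)
  simp only [sliceMap_apply, rePart_mul, imPart_mul]
  simp only [← componentHom_apply, map_sub, map_add, map_mul] at h1 h2 ⊢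
  set a := componentHom V (rePart V X)
  set b := componentHom V (imPart V X)
  set c := componentHom V (rePart V Y)
  set d := componentHom V (imPart V Y)
  set J := imagUnit V I with hJ
  have e1 : a * (J * d) = J * (a * d) := by rw [← mul_assoc, ← h1.eq, mul_assoc]
  have e2 : J * b * (J * d) = -(b * d) := by
    rw [mul_assoc, ← mul_assoc b, ← h2.eq, mul_assoc, ← mul_assoc, imagUnit_mul_self hI,
      neg_one_mul]
  rw [add_mul, mul_add, mul_add, mul_add, e1, e2, mul_assoc J b c]
  abel

/-- Paravectors in `ℂ_I` thus become complex scalars, which commute with everything upstairs; this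
is why the left and right forms coincide. -/
theorem sliceMap_smul {I : EuclideanSpace ℝ (Fin 5)} (hI : I ∈ unitSphere) (c : ℂ)
    (X : Complexify V →L[ℂ] Complexify V) :
    sliceMap V I (c • X) = para (slicePoint I c) * sliceMap V I X := by
  rw [para_slicePoint, add_mul, smul_one_mul, smul_mul_assoc]
  simp only [sliceMap_apply, rePart_smul, imPart_smul]
  simp only [← componentHom_apply, map_sub, map_add, map_smul, mul_add, ← mul_assoc,
    imagUnit_mul_self hI, mul_smul_comm, smul_add, neg_one_mul, smul_neg]
  abel

theorem para_slicePoint_eq {I : EuclideanSpace ℝ (Fin 5)} (hI : I ∈ unitSphere) (c : ℂ) :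
    (para (slicePoint I c) : CliffordOp V) = sliceMap V I (c • 1) := by
  rw [sliceMap_smul hI, sliceMap_one, mul_one]

theorem sliceMap_pow {I : EuclideanSpace ℝ (Fin 5)} (hI : I ∈ unitSphere)
    (X : Complexify V →L[ℂ] Complexify V) (n : ℕ) :
    sliceMap V I (X ^ n) = sliceMap V I X ^ n := by
  induction n with
  | zero => rw [pow_zero, pow_zero, sliceMap_one]
  | succ n ih => rw [pow_succ, pow_succ, sliceMap_mul hI, ih]

end SliceHom

/-! ### The operator `T` -/

namespace ParavectorOp

open Complexify

variable {V : Type u} [NormedAddCommGroup V] [NormedSpace ℝ V] (T : ParavectorOp V)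

/-- The complexification of `-∑ T_i²`, which is `T²` if `T_0 = 0`. -/
def sqOp : Complexify V →L[ℂ] Complexify V := -∑ i : Fin 5, extendHom (T.comp i.succ) ^ 2

theorem sqOp_eq : T.sqOp = -extendHom (∑ i : Fin 5, T.comp i.succ ^ 2) := by
  simp only [sqOp, map_sum, map_pow]

variable {T} (hT0 : T.comp 0 = 0)
include hT0

theorem op_eq : T.op = ∑ i : Fin 5, e i * ofComponent (T.comp i.succ) := by
  rw [op, hT0, ← componentHom_apply, map_zero, zero_add]

theorem conj_eq : T.conj = -T.op := by
  rw [op_eq hT0, conj, hT0, ← componentHom_apply, map_zero, zero_sub]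

theorem op_mul_op : T.op * T.op = -ofComponent (∑ i : Fin 5, T.comp i.succ ^ 2) := by
  rw [op_eq hT0, sum_e_mul_mul_self]
  · simp only [← componentHom_apply, map_sum, map_mul, pow_two]
  · intro i j
    exact (T.commute i.succ j.succ).map (componentHom V)
  · exact fun i j => commute_e_ofComponent i _

/-- The linear term disappears because `T` plus its conjugate is `0`, which leaves `s² - T²`. -/
theorem Qc_slicePoint {I : EuclideanSpace ℝ (Fin 5)} (hI : I ∈ unitSphere) (z : ℂ) :
    T.Qc (slicePoint I z) = sliceMap V I (algebraMap ℂ _ (z ^ 2) - T.sqOp) := by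
  rw [Qc, conj_eq hT0, add_neg_cancel, mul_zero, sub_zero, mul_neg, op_mul_op hT0, neg_neg,
    sqOp_eq, sub_neg_eq_add, map_add, sliceMap_extendHom, Algebra.algebraMap_eq_smul_one,
    para_slicePoint_eq hI, ← sliceMap_pow hI, smul_pow, one_pow]

theorem harmonicResolvent_slicePoint {I : EuclideanSpace ℝ (Fin 5)} (hI : I ∈ unitSphere) {z : ℂ}
    (hz : z ^ 2 ∈ resolventSet ℂ T.sqOp) :
    T.harmonicResolvent (slicePoint I z) =
      sliceMap V I ((16 : ℂ) • resolvent T.sqOp (z ^ 2) ^ 2) := by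
  have h1 : (algebraMap ℂ _ (z ^ 2) - T.sqOp) * resolvent T.sqOp (z ^ 2) = 1 :=
    Ring.mul_inverse_cancel _ hz
  have h2 : resolvent T.sqOp (z ^ 2) * (algebraMap ℂ _ (z ^ 2) - T.sqOp) = 1 :=
    Ring.inverse_mul_cancel _ hz
  have h3 : Ring.inverse (T.Qc (slicePoint I z)) = sliceMap V I (resolvent T.sqOp (z ^ 2)) := by
    rw [Qc_slicePoint hT0 hI]
    exact Ring.inverse_unit (M₀ := CliffordOp V)
      ⟨sliceMap V I (algebraMap ℂ _ (z ^ 2) - T.sqOp), sliceMap V I (resolvent T.sqOp (z ^ 2)),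
        by rw [← sliceMap_mul hI, h1, sliceMap_one], by rw [← sliceMap_mul hI, h2, sliceMap_one]⟩
  have h4 : ((16 : ℂ) • resolvent T.sqOp (z ^ 2) ^ 2) = (16 : ℝ) • resolvent T.sqOp (z ^ 2) ^ 2 := by
    rw [← Complex.coe_smul]; norm_num
  rw [harmonicResolvent, h3, h4, map_smul, sliceMap_pow hI]

/-- The constants combine as `16 · (-i) / (32π) = (2πi)⁻¹`. -/
theorem leftForm_eq {I : EuclideanSpace ℝ (Fin 5)} (hI : I ∈ unitSphere) {z : ℂ}
    (hz : z ^ 2 ∈ resolventSet ℂ T.sqOp) (w : ℂ) :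
    (1 / (32 * Real.pi)) • leftForm T I z w = sliceMap V I
      ((2 * Real.pi * Complex.I : ℂ)⁻¹ • w • z ^ 3 • resolvent T.sqOp (z ^ 2) ^ 2) := by
  rw [leftForm, dsI, harmonicResolvent_slicePoint hT0 hI hz]
  simp only [para_slicePoint_eq hI, ← sliceMap_pow hI, ← sliceMap_mul hI, ← map_neg, ← map_smul]
  congr 1
  rw [← Complex.coe_smul]
  simp only [smul_pow, one_pow, smul_mul_assoc, mul_smul_comm, one_mul, mul_one, smul_smul,
    ← neg_smul]
  congr 1
  have := Real.pi_pos.ne'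
  push_cast
  field_simp
  linear_combination (-32 * z ^ 3 * w) * Complex.I_sq

theorem rightForm_eq {I : EuclideanSpace ℝ (Fin 5)} (hI : I ∈ unitSphere) {z : ℂ}
    (hz : z ^ 2 ∈ resolventSet ℂ T.sqOp) (w : ℂ) :
    (1 / (32 * Real.pi)) • rightForm T I z w = sliceMap V I
      ((2 * Real.pi * Complex.I : ℂ)⁻¹ • w • z ^ 3 • resolvent T.sqOp (z ^ 2) ^ 2) := by
  rw [← leftForm_eq hT0 hI hz, leftForm, rightForm, dsI, harmonicResolvent_slicePoint hT0 hI hz]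
  simp only [para_slicePoint_eq hI, ← sliceMap_pow hI, ← sliceMap_mul hI, ← map_neg]
  congr 2
  simp only [smul_pow, one_pow, smul_mul_assoc, mul_smul_comm, one_mul, mul_one, smul_smul,
    ← neg_smul]
  congr 1
  ring

omit hT0 in
-- Compress the inverse to the coefficient of `e_∅ = 1`; both the inclusion and the projection of
-- that coefficient intertwine `A` with its action on `V₅`.
theorem _root_.Clifford5.isUnit_of_isUnit_ofComponent {A : V →L[ℝ] V}
    (h : IsUnit (ofComponent A)) : IsUnit A := by
  obtain ⟨⟨a, b, hab, hba⟩, rfl : a = ofComponent A⟩ := h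
  let ι : V →L[ℝ] CliffordModule V := ContinuousLinearMap.single ℝ (fun _ => V) ∅
  let π : CliffordModule V →L[ℝ] V := ContinuousLinearMap.proj ∅
  let R : CliffordModule V →L[ℝ] CliffordModule V := b
  have hπι : ∀ v, π (ι v) = v := fun v => by simp [π, ι]
  have hA1 : ∀ v, π ((ofComponent A : CliffordModule V →L[ℝ] CliffordModule V) v) = A (π v) :=
    fun v => rfl
  have hA2 : ∀ v, (ofComponent A : CliffordModule V →L[ℝ] CliffordModule V) (ι v) = ι (A v) := by
    intro v
    ext C
    rw [coe_ofComponent_apply]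
    by_cases hC : C = ∅
    · subst hC; simp [ι]
    · simp [ι, hC]
  have h1 : ∀ v, (ofComponent A : CliffordModule V →L[ℝ] CliffordModule V) (R v) = v :=
    fun v => DFunLike.congr_fun (congrArg Subtype.val hab) v
  have h2 : ∀ v, R ((ofComponent A : CliffordModule V →L[ℝ] CliffordModule V) v) = v :=
    fun v => DFunLike.congr_fun (congrArg Subtype.val hba) v
  refine ⟨⟨A, π.comp (R.comp ι), ?_, ?_⟩, rfl⟩
  · ext v
    change A (π (R (ι v))) = v
    rw [← hA1, h1, hπι]
  · ext v
    change π (R (ι (A v))) = v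
    rw [← hA2, h2, hπι]

omit hT0 in
-- The real quadratic expression in `complexSpectrum` factors upstairs as `(z - A)(conj z - A)`, and
-- commuting factors of a unit are units.
theorem _root_.Clifford5.HasRealSpectrum.im_eq_zero {A : V →L[ℝ] V} (h : HasRealSpectrum A) {z : ℂ}
    (hz : z ∈ spectrum ℂ (extendHom A)) : z.im = 0 := by
  refine h z fun hu => hz ?_
  set c : ℂ →+* (Complexify V →L[ℂ] Complexify V) := algebraMap ℂ _ with hc
  have hcr : ∀ r : ℝ, extendHom (r • (1 : V →L[ℝ] V)) = c r := fun r => by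
    rw [map_smul, map_one, hc, Algebra.algebraMap_eq_smul_one, Complex.coe_smul]
  have hcomm : ∀ x, Commute (c x) (extendHom A) := fun x => Algebra.commutes x _
  have hprod : extendHom ((A - z.re • (1 : V →L[ℝ] V)) ^ 2 + (z.im ^ 2) • (1 : V →L[ℝ] V)) =
      (c z - extendHom A) * (c (starRingEnd ℂ z) - extendHom A) := by
    have e1 : c z = c z.re + c z.im * c Complex.I := by
      rw [← map_mul, ← map_add, Complex.re_add_im]
    have e2 : c (starRingEnd ℂ z) = c z.re - c z.im * c Complex.I := by
      rw [← map_mul, ← map_sub]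
      congr 1
      apply Complex.ext <;> simp
    have e3 : c Complex.I * c Complex.I = -1 := by
      rw [← map_mul, Complex.I_mul_I, map_neg, map_one]
    have k1 := (hcomm z.re).eq
    have k2 := (hcomm (z.im * Complex.I)).eq
    have k3 : c z.re * c (z.im * Complex.I) = c (z.im * Complex.I) * c z.re := by
      rw [← map_mul, mul_comm, map_mul]
    have e4 : c (z.im * Complex.I) * c (z.im * Complex.I) = -(c z.im * c z.im) := by
      rw [← map_mul, ← map_mul, ← map_neg]
      congr 1
      linear_combination (z.im : ℂ) ^ 2 * Complex.I_mul_I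
    rw [map_add, map_pow, map_sub, hcr, hcr, e1, e2, ← map_mul, Complex.ofReal_pow, map_pow]
    simp only [pow_two, sub_mul, mul_sub, add_mul, e4, k1, k2, k3]
    abel
  have hcomm' : Commute (c z - extendHom A) (c (starRingEnd ℂ z) - extendHom A) :=
    Commute.sub_left (Commute.sub_right (Algebra.commutes _ _) (hcomm _))
      (Commute.sub_right (hcomm _).symm (Commute.refl _))
  have hu' := hu.map (extendHom (V := V))
  rw [hprod] at hu'
  exact (hcomm'.isUnit_mul_iff.1 hu').1

omit hT0 in
theorem re_eq_zero_of_sq_mem_spectrum_sqOp [CompleteSpace V]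
    (hreal : ∀ i : Fin 5, HasRealSpectrum (T.comp i.succ)) {z : ℂ}
    (hz : z ^ 2 ∈ spectrum ℂ T.sqOp) : z.re = 0 :=
  re_eq_zero_of_sq_mem_spectrum (fun i : Fin 5 => extendHom (T.comp i.succ))
    (fun i j => (T.commute i.succ j.succ).map extendHom)
    (fun i _ hz => (hreal i).im_eq_zero hz) hz

omit hT0 in
theorem _root_.Clifford5.norm_slicePoint_sq {I : EuclideanSpace ℝ (Fin 5)} (hI : I ∈ unitSphere)
    (z : ℂ) : ‖slicePoint I z‖ ^ 2 = z.re ^ 2 + z.im ^ 2 := by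
  have h1 : ‖I‖ = 1 := by simpa [unitSphere] using hI
  have h2 := EuclideanSpace.real_norm_sq_eq I
  rw [h1, one_pow] at h2
  rw [EuclideanSpace.real_norm_sq_eq, Fin.sum_univ_succ]
  simp [slicePoint, mul_pow, ← Finset.mul_sum, ← h2]

/-- For `s = Iv` the operator defining the `S`-spectrum is `T² + v²`, which acts on components;
upstairs it is the negative of `z² - B`, since `z² = -v²`. -/
theorem slicePoint_mem_sSpectrum {I : EuclideanSpace ℝ (Fin 5)} (hI : I ∈ unitSphere) {z : ℂ}
    (hre : z.re = 0) (hz : z ^ 2 ∈ spectrum ℂ T.sqOp) : slicePoint I z ∈ T.sSpectrum := by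
  intro hu
  refine hz ?_
  have h0 : slicePoint I z 0 = z.re := rfl
  have hz2 : z ^ 2 = ((-(z.im ^ 2) : ℝ) : ℂ) := by
    conv_lhs => rw [← Complex.re_add_im z, hre]
    push_cast
    linear_combination (z.im : ℂ) ^ 2 * Complex.I_sq
  set A : V →L[ℝ] V := ∑ i : Fin 5, T.comp i.succ ^ 2 with hA
  rw [h0, hre, mul_zero, zero_smul, sub_zero, norm_slicePoint_sq hI, hre, pow_two T.op,
    op_mul_op hT0] at hu
  have h1 : -ofComponent A + (0 ^ 2 + z.im ^ 2) • (1 : CliffordOp V) =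
      ofComponent (-A + z.im ^ 2 • (1 : V →L[ℝ] V)) := by
    rw [← componentHom_apply, ← componentHom_apply, map_add, map_neg, map_smul, map_one]
    norm_num
  rw [← hA, h1] at hu
  have h2 := ((isUnit_of_isUnit_ofComponent hu).map (extendHom (V := V))).neg
  change IsUnit (algebraMap ℂ _ (z ^ 2) - T.sqOp)
  rw [sqOp_eq, sub_neg_eq_add, ← hA, hz2, Algebra.algebraMap_eq_smul_one, Complex.coe_smul]
  convert h2 using 1
  rw [map_add, map_neg, map_smul, map_one, neg_smul]
  abel

end ParavectorOp

/-! ### Slices of axially symmetric sets -/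

theorem slicePoint_neg (I : EuclideanSpace ℝ (Fin 5)) (z : ℂ) :
    slicePoint (-I) z = slicePoint I (starRingEnd ℂ z) := by
  ext j
  refine Fin.cases ?_ (fun i => ?_) j
  · simp [slicePoint]
  · simp [slicePoint]

theorem neg_mem_unitSphere {I : EuclideanSpace ℝ (Fin 5)} (hI : I ∈ unitSphere) :
    -I ∈ unitSphere := by
  simpa [unitSphere] using hI

theorem norm_vecPart_slicePoint {I : EuclideanSpace ℝ (Fin 5)} (hI : I ∈ unitSphere) (z : ℂ) :
    ‖vecPart (slicePoint I z)‖ = |z.im| := by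
  have h1 : ‖I‖ = 1 := by simpa [unitSphere] using hI
  have h2 : vecPart (slicePoint I z) = z.im • I := by
    ext i
    simp [vecPart, slicePoint]
  rw [h2, norm_smul, h1, mul_one, Real.norm_eq_abs]

theorem continuous_slicePoint (I : EuclideanSpace ℝ (Fin 5)) : Continuous (slicePoint I) := by
  refine (PiLp.continuous_toLp 2 _).comp (continuous_pi fun j => ?_)
  refine Fin.cases ?_ (fun i => ?_) j
  · exact Complex.continuous_re
  · exact Complex.continuous_im.mul continuous_const

variable {U : Set (EuclideanSpace ℝ (Fin 6))} {I J : EuclideanSpace ℝ (Fin 5)}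

theorem AxiallySymmetric.mem_slice (hU : AxiallySymmetric U) (hI : I ∈ unitSphere)
    (hJ : J ∈ unitSphere) {z : ℂ} (hz : z ∈ slice U I) : z ∈ slice U J := by
  have h : ∀ K ∈ unitSphere, slicePoint K ⟨z.re, |z.im|⟩ ∈ U := fun K hK => by
    have := hU _ hz K hK
    rwa [norm_vecPart_slicePoint hI] at this
  -- Axial symmetry only reaches points with imaginary part `|z.im|`; the lower half plane of `ℂ_J`
  -- is the upper half plane of `ℂ_{-J}`.
  rcases le_total 0 z.im with h0 | h0
  · have := h J hJ
    rwa [abs_of_nonneg h0] at this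
  · have := h (-J) (neg_mem_unitSphere hJ)
    rw [abs_of_nonpos h0, slicePoint_neg] at this
    have e : starRingEnd ℂ ⟨z.re, -z.im⟩ = z := by apply Complex.ext <;> simp
    rwa [e] at this

theorem AxiallySymmetric.slice_eq (hU : AxiallySymmetric U) (hI : I ∈ unitSphere)
    (hJ : J ∈ unitSphere) : slice U I = slice U J :=
  Subset.antisymm (fun _ => hU.mem_slice hI hJ) fun _ => hU.mem_slice hJ hI

theorem AxiallySymmetric.conj_mem_slice (hU : AxiallySymmetric U) (hI : I ∈ unitSphere) {z : ℂ}
    (hz : z ∈ slice U I) : starRingEnd ℂ z ∈ slice U I := by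
  have := hU.mem_slice hI (neg_mem_unitSphere hI) hz
  change slicePoint (-I) z ∈ U at this
  rwa [slicePoint_neg] at this

theorem conj_mem_closure {D : Set ℂ} (hD : ∀ z ∈ D, starRingEnd ℂ z ∈ D) {z : ℂ}
    (hz : z ∈ closure D) : starRingEnd ℂ z ∈ closure D :=
  map_mem_closure Complex.continuous_conj hz hD

theorem isOpen_slice (hU : IsOpen U) : IsOpen (slice U I) :=
  hU.preimage (continuous_slicePoint I)

theorem closure_slice_subset : closure (slice U I) ⊆ slice (closure U) I :=
  (continuous_slicePoint I).closure_preimage_subset U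

/-- Separation from a set is inherited by the closure. -/
theorem notMem_closure_of_areSeparated {X : Type*} [PseudoEMetricSpace X] {s t : Set X}
    (h : Metric.AreSeparated s t) {x : X} (hx : x ∈ t) : x ∉ closure s := by
  obtain ⟨r, hr, hst⟩ := h
  intro hxs
  obtain ⟨y, hy, hxy⟩ := EMetric.mem_closure_iff.1 hxs r (pos_iff_ne_zero.2 hr)
  exact absurd (hst y hy x hx) (not_le.2 (by rwa [edist_comm]))

/-! ### Integrals over the boundary -/

section Boundary

variable {m : ℕ} {D : Set ℂ} {γ : Fin m → ℝ → ℂ}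

theorem IsPositiveBoundary.isClosedCurve (hγ : IsPositiveBoundary D γ) (k : Fin m) :
    IsClosedCurve (γ k) := (hγ.jordan k).isClosedCurve

theorem IsPositiveBoundary.isSpectralProjection {A : Type*} [NormedRing A] [NormedAlgebra ℂ A]
    [CompleteSpace A] {B : A} (hγ : IsPositiveBoundary D γ) (hD : IsOpen D)
    {N₁ N₂ : Set ℂ} (hN₁ : ∀ z ∈ N₁, z ∈ D ∧ -z ∈ D)
    (hN₂ : ∀ z ∈ N₂, z ∉ closure D ∧ -z ∉ closure D)
    (hB : ∀ w ∈ cycleSupport γ, w ^ 2 ∈ resolventSet ℂ B) :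
    IsSpectralProjection B N₁ N₂ ((2 * Real.pi * Complex.I : ℂ)⁻¹ •
      cycleIntegral γ (fun w => w ^ 3 • resolvent B (w ^ 2) ^ 2)) := by
  have hfr : cycleSupport γ = frontier D := hγ.frontier_eq
  rw [cycleIntegral_pow_three_smul hγ.isClosedCurve hB]
  refine cycleIntegral_isSpectralProjection hγ.isClosedCurve hB ?_ ?_
  · intro z hz
    obtain ⟨h1, h2⟩ := hN₁ z hz
    refine ⟨fun w hw hwz => ?_, hγ.inside _ h1, hγ.inside _ h2⟩
    rw [hfr, hD.frontier_eq] at hw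
    rcases sq_eq_sq_iff_eq_or_eq_neg.1 hwz with rfl | rfl
    exacts [hw.2 h1, hw.2 h2]
  · intro z hz
    obtain ⟨h1, h2⟩ := hN₂ z hz
    refine ⟨fun w hw hwz => ?_, hγ.outside _ h1, hγ.outside _ h2⟩
    rw [hfr] at hw
    rcases sq_eq_sq_iff_eq_or_eq_neg.1 hwz with rfl | rfl
    exacts [h1 (frontier_subset_closure hw), h2 (frontier_subset_closure hw)]

theorem cycleSupport_subset_resolvent {A : Type*} [NormedRing A] [NormedAlgebra ℂ A] {B : A}
    (hγ : IsPositiveBoundary D γ) (hD : IsOpen D)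
    {N₁ N₂ : Set ℂ} (hN₁ : ∀ z ∈ N₁, z ∈ D ∧ -z ∈ D)
    (hN₂ : ∀ z ∈ N₂, z ∉ closure D ∧ -z ∉ closure D)
    (hcover : ∀ z : ℂ, z ^ 2 ∈ spectrum ℂ B → z ∈ N₁ ∪ N₂) :
    ∀ w ∈ cycleSupport γ, w ^ 2 ∈ resolventSet ℂ B := by
  intro w hw
  have hfr : cycleSupport γ = frontier D := hγ.frontier_eq
  rw [hfr] at hw
  by_contra hws
  rcases hcover w hws with h | h
  · rw [hD.frontier_eq] at hw
    exact hw.2 (hN₁ w h).1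
  · exact (hN₂ w h).1 (frontier_subset_closure hw)

end Boundary

/-! ### The two boundary integrals and the projector. -/

section Main

open Complexify

variable {V : Type u} [NormedAddCommGroup V] [NormedSpace ℝ V] [CompleteSpace V]

/-- Each parametrization of the boundary produces a spectral projection for the same `N₁`, `N₂`.
Uniqueness identifies it with `P`, so the value depends neither on the parametrization nor on the
domain `D`. -/
theorem hasBoundaryIntegral_of_eq_sliceMap {T : ParavectorOp V} {D : Set ℂ} (hD : IsOpen D)
    {N₁ N₂ : Set ℂ} (h₁ : IsOpen N₁) (h₂ : IsOpen N₂)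
    (hN₁ : ∀ z ∈ N₁, z ∈ D ∧ -z ∈ D) (hN₂ : ∀ z ∈ N₂, z ∉ closure D ∧ -z ∉ closure D)
    (hcover : ∀ z : ℂ, z ^ 2 ∈ spectrum ℂ T.sqOp → z ∈ N₁ ∪ N₂)
    {P : Complexify V →L[ℂ] Complexify V} (hP : IsSpectralProjection T.sqOp N₁ N₂ P)
    {F : ℂ → ℂ → CliffordOp V}
    (hF : ∀ z : ℂ, z ^ 2 ∈ resolventSet ℂ T.sqOp → ∀ w, F z w = sliceMap V I
      ((2 * Real.pi * Complex.I : ℂ)⁻¹ • w • z ^ 3 • resolvent T.sqOp (z ^ 2) ^ 2)) :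
    HasBoundaryIntegral D F (sliceMap V I P) := by
  intro m γ hγ
  have hB := cycleSupport_subset_resolvent hγ hD hN₁ hN₂ hcover
  have hPγ := hP.unique h₁ h₂ hcover (hγ.isSpectralProjection hD hN₁ hN₂ hB)
  have hcont : ContinuousOn (fun w : ℂ => w ^ 3 • resolvent T.sqOp (w ^ 2) ^ 2)
      (cycleSupport γ) :=
    (continuous_pow 3).continuousOn.smul ((continuousOn_resolvent_sq hB).pow 2)
  let L : (Complexify V →L[ℂ] Complexify V) →L[ℝ] CliffordOp V :=
    (sliceMap V I).comp ((2 * Real.pi * Complex.I : ℂ)⁻¹ •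
      ContinuousLinearMap.id ℝ (Complexify V →L[ℂ] Complexify V))
  have hint := cycle_intervalIntegrable hγ.isClosedCurve hcont
  have hFL : ∀ k, ∀ t ∈ Icc (0 : ℝ) 1, F (γ k t) (deriv (γ k) t) =
      L (deriv (γ k) t • γ k t ^ 3 • resolvent T.sqOp (γ k t ^ 2) ^ 2) := fun k t ht =>
    hF _ (hB _ (mem_cycleSupport γ k ht)) _
  refine ⟨fun k => ?_, ?_⟩
  · have h : IntervalIntegrable (fun t => L (deriv (γ k) t • γ k t ^ 3 •
        resolvent T.sqOp (γ k t ^ 2) ^ 2)) volume 0 1 :=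
      ⟨L.integrable_comp (hint k).1, L.integrable_comp (hint k).2⟩
    refine h.congr fun t ht => ?_
    rw [uIoc_of_le zero_le_one] at ht
    exact (hFL k t (Ioc_subset_Icc_self ht)).symm
  · have h : ∀ k, ∫ t in (0 : ℝ)..1, F (γ k t) (deriv (γ k) t) =
        L (∫ t in (0 : ℝ)..1, deriv (γ k) t • γ k t ^ 3 • resolvent T.sqOp (γ k t ^ 2) ^ 2) := by
      intro k
      rw [← L.intervalIntegral_comp_comm (hint k)]
      refine intervalIntegral.integral_congr fun t ht => ?_
      rw [uIcc_of_le zero_le_one] at ht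
      exact hFL k t ht
    simp only [h]
    rw [← map_sum, hPγ]
    rfl

/-- The two boundary integrals define one and the same projector, independent of the imaginary
unit. The separation of the two parts of the spectrum is a consequence of that of `G₂` and `σ₂`. -/
theorem exists_mul_self_eq_and_hasBoundaryIntegral (T : ParavectorOp V) (hT0 : T.comp 0 = 0)
    (hreal : ∀ i : Fin 5, HasRealSpectrum (T.comp i.succ))
    {σ₁ σ₂ : Set (EuclideanSpace ℝ (Fin 6))} (hσ : T.sSpectrum = σ₁ ∪ σ₂)
    {G₁ G₂ : Set (EuclideanSpace ℝ (Fin 6))}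
    (hG₁ : IsSliceCauchyDomain G₁) (hG₂ : IsSliceCauchyDomain G₂)
    (hσG : σ₁ ⊆ G₁) (hGG : closure G₁ ⊆ G₂) (hGσ : Metric.AreSeparated G₂ σ₂) :
    ∃ P : CliffordOp V, P * P = P ∧
      ∀ I ∈ unitSphere,
        HasBoundaryIntegral (slice G₁ I) (fun z w => (1 / (32 * Real.pi)) • rightForm T I z w) P ∧
        HasBoundaryIntegral (slice G₂ I)
          (fun z w => (1 / (32 * Real.pi)) • leftForm T I z w) P := by
  -- A reference unit: by axial symmetry every `I ∈ 𝕊` yields the same plane domains.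
  let K : EuclideanSpace ℝ (Fin 5) := EuclideanSpace.single 0 1
  have hK : K ∈ unitSphere := by simp [K, unitSphere]
  set D₁ := slice G₁ K with hD₁
  set D₂ := slice G₂ K with hD₂
  have hD₁o : IsOpen D₁ := isOpen_slice hG₁.isOpen
  have hD₂o : IsOpen D₂ := isOpen_slice hG₂.isOpen
  have hD12 : D₁ ⊆ D₂ := fun z hz => hGG (subset_closure hz)
  have hconj₁ : ∀ z ∈ D₁, starRingEnd ℂ z ∈ D₁ := fun z hz =>
    hG₁.axiallySymmetric.conj_mem_slice hK hz
  have hconj₂ : ∀ z ∈ D₂, starRingEnd ℂ z ∈ D₂ := fun z hz =>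
    hG₂.axiallySymmetric.conj_mem_slice hK hz
  -- Both sets are invariant under `z ↦ -z`, as suits a condition on `z²`; `N₁` lies inside both
  -- domains and `N₂` outside both closures, so one pair serves `G₁` and `G₂`.
  set N₁ : Set ℂ := {z | z ∈ D₁ ∧ -z ∈ D₁} with hN₁
  set N₂ : Set ℂ := {z | z ∉ closure D₂ ∧ -z ∉ closure D₂} with hN₂
  have h₁ : IsOpen N₁ := hD₁o.inter (hD₁o.preimage continuous_neg)
  have h₂ : IsOpen N₂ :=
    isClosed_closure.isOpen_compl.inter (isClosed_closure.isOpen_compl.preimage continuous_neg)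
  have hdisj : Disjoint N₁ N₂ :=
    disjoint_left.2 fun z hz hz' => hz'.1 (subset_closure (hD12 hz.1))
  have hcover : ∀ z : ℂ, z ^ 2 ∈ spectrum ℂ T.sqOp → z ∈ N₁ ∪ N₂ := by
    intro z hz
    have hre := ParavectorOp.re_eq_zero_of_sq_mem_spectrum_sqOp hreal hz
    -- Here real spectra are essential: conjugation symmetry of the slices becomes symmetry under `z
    -- ↦ -z` at the spectral points.
    have hcz : starRingEnd ℂ z = -z := by apply Complex.ext <;> simp [hre]
    have hz' : (-z) ^ 2 ∈ spectrum ℂ T.sqOp := by rwa [neg_sq]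
    have m1 : slicePoint K z ∈ σ₁ ∪ σ₂ :=
      hσ ▸ ParavectorOp.slicePoint_mem_sSpectrum hT0 hK hre hz
    have m2 : slicePoint K (-z) ∈ σ₁ ∪ σ₂ :=
      hσ ▸ ParavectorOp.slicePoint_mem_sSpectrum hT0 hK (by simp [hre]) hz'
    have hout : ∀ y, slicePoint K y ∈ σ₂ → y ∉ closure D₂ := fun y hy hyD =>
      notMem_closure_of_areSeparated hGσ hy (closure_slice_subset hyD)
    rcases m1 with m1 | m1
    · refine Or.inl ⟨hσG m1, ?_⟩
      rw [← hcz]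
      exact hconj₁ z (hσG m1)
    · refine Or.inr ⟨hout z m1, fun hn => hout z m1 ?_⟩
      have := conj_mem_closure hconj₂ hn
      rwa [← hcz, starRingEnd_self_apply] at this
  have hN₁D₂ : ∀ z ∈ N₁, z ∈ D₂ ∧ -z ∈ D₂ := fun z hz => ⟨hD12 hz.1, hD12 hz.2⟩
  have hN₂D₁ : ∀ z ∈ N₂, z ∉ closure D₁ ∧ -z ∉ closure D₁ := fun z hz =>
    ⟨fun h => hz.1 (closure_mono hD12 h), fun h => hz.2 (closure_mono hD12 h)⟩
  obtain ⟨-, m, γ, hγ⟩ := hG₁.cauchyDomain K hK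
  obtain ⟨P, hP⟩ : ∃ P, IsSpectralProjection T.sqOp N₁ N₂ P :=
    ⟨_, hγ.isSpectralProjection hD₁o (fun z hz => hz) hN₂D₁
      (cycleSupport_subset_resolvent hγ hD₁o (fun z hz => hz) hN₂D₁ hcover)⟩
  have hPP := hP.mul_self h₁ h₂ hdisj hcover
  -- `B` is real and `N₁`, `N₂` are stable under conjugation, so the conjugate of `P` has the same
  -- characterization as `P`.
  have hconjP : conjOp V P = P := by
    refine (IsSpectralProjection.conj conjOp_mul ?_ conjOp_smul ?_ h₁ h₂ ?_ ?_ hP).unique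
      h₁ h₂ hcover hP
    · rw [← map_one (extendHom (V := V)), conjOp_extendHom]
    · rw [ParavectorOp.sqOp_eq, map_neg, conjOp_extendHom]
    · intro z hz
      exact ⟨hconj₁ _ hz.1, by rw [← map_neg]; exact hconj₁ _ hz.2⟩
    · intro z hz
      refine ⟨fun h => hz.1 ?_, fun h => hz.2 ?_⟩
      · simpa using conj_mem_closure hconj₂ h
      · simpa using conj_mem_closure hconj₂ h
  have hslice : ∀ I, sliceMap V I P = ofComponent (rePart V P) := fun I => by
    rw [sliceMap_apply, imPart_eq_zero_of_conjOp_eq hconjP, ← componentHom_apply 0, map_zero,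
      mul_zero, add_zero]
  refine ⟨sliceMap V K P, by rw [← sliceMap_mul hK, hPP], fun I hI => ?_⟩
  rw [hslice K, ← hslice I, hG₁.axiallySymmetric.slice_eq hI hK,
    hG₂.axiallySymmetric.slice_eq hI hK]
  exact ⟨hasBoundaryIntegral_of_eq_sliceMap hD₁o h₁ h₂ (fun z hz => hz) hN₂D₁ hcover hP
      fun z hz w => ParavectorOp.rightForm_eq hT0 hI hz w,
    hasBoundaryIntegral_of_eq_sliceMap hD₂o h₁ h₂ hN₁D₂ (fun z hz => hz) hcover hP
      fun z hz w => ParavectorOp.leftForm_eq hT0 hI hz w⟩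

end Main

end Clifford5

end

theorem mainTheorem6 {V : Type*} [NormedAddCommGroup V] [NormedSpace ℝ V] [CompleteSpace V]
    (T : Clifford5.ParavectorOp V) (hT0 : T.comp 0 = 0)
    (hreal : ∀ i : Fin 5, Clifford5.HasRealSpectrum (T.comp i.succ))
    (σ₁ σ₂ : Set (EuclideanSpace ℝ (Fin 6))) (hσ : T.sSpectrum = σ₁ ∪ σ₂)
    (hsep : Metric.AreSeparated σ₁ σ₂)
    (G₁ G₂ : Set (EuclideanSpace ℝ (Fin 6)))
    (hG₁ : Clifford5.IsSliceCauchyDomain G₁) (hG₁b : Bornology.IsBounded G₁)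
    (hG₂ : Clifford5.IsSliceCauchyDomain G₂) (hG₂b : Bornology.IsBounded G₂)
    (hσG : σ₁ ⊆ G₁) (hGG : closure G₁ ⊆ G₂) (hGσ : Metric.AreSeparated G₂ σ₂) :
    ∃ P : Clifford5.CliffordOp V, P * P = P ∧
      ∀ I ∈ Clifford5.unitSphere,
        Clifford5.HasBoundaryIntegral (Clifford5.slice G₁ I)
          (fun z w => (1 / (32 * Real.pi)) • Clifford5.rightForm T I z w) P ∧
        Clifford5.HasBoundaryIntegral (Clifford5.slice G₂ I)
          (fun z w => (1 / (32 * Real.pi)) • Clifford5.leftForm T I z w) P :=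
  Clifford5.exists_mul_self_eq_and_hasBoundaryIntegral T hT0 hreal hσ hG₁ hG₂ hσG hGG hGσ
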